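/- **Setting.** For each $n\ge 1$ let $\{T_n^{(k)}\}_k$ be a homogeneous Poisson process on $\mathbb{R}^n$ of intensity $e^{n\rho_n}$, where $\rho_n\to\rho\in\mathbb{R}$ as $n\to\infty$. Let its points carry i.i.d. marks $X_n^{(k)}\ge 0$, independent of the points and distributed like $\bar X_n$. Assume that $\mathbb{E}[\bar X_n]\to R^*$ with $0<R^*<\infty$, that $(\bar X_n)_{n\ge 1}$ satisfies a large deviations principle on $\mathbb{R}$ with speed $n$ and with a good and convex rate function $I:\mathbb{R}\to[0,\infty]$, and that $\limsup_{n\to\infty}\mathbb{E}[(\bar X_n)^{\gamma n}]^{1/n}<\infty$ for some $\gamma>1$. The grain of the point $T_n^{(k)}$ is the closed Euclidean ball of center $T_n^{(k)}$ and radius $X_n^{(k)}\sqrt n$. Let $\mathbb{P}^0_n$ be the Palm probability of the marked point process in dimension $n$, with expectation $\mathbb{E}^0_n$, and let $D_n$ be the number of points other than the origin whose ball intersects the ball of the point at the origin. **Theorem.** Set $$\tau_d=-\tfrac12\log(2\pi e)+\inf_{R\ge 2R^*}\Bigl(2I\bigl(\tfrac R2\bigr)-\log R\Bigr).$$ Then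 $\tau_d$ is a real number, and $$\lim_{n\to\infty}\frac1n\log \mathbb{E}^0_n[D_n]=\rho-\tau_d .$$ Moreover $\tau_d$ is the degree threshold: if $\rho<\tau_d$, then $\mathbb{E}^0_n[D_n]\to 0$ exponentially fast, that is, for some $c>0$, $\mathbb{E}^0_n[D_n]\le e^{-cn}$ for all large $n$; if $\rho>\tau_d$, then $\mathbb{E}^0_n[D_n]\to\infty$ exponentially fast, that is, for some $c>0$, $\mathbb{E}^0_n[D_n]\ge e^{cn}$ for all large $n$. -/

import Mathlib

open MeasureTheory ProbabilityTheory Filter Topology Set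
open scoped NNReal ENNReal

noncomputable section

namespace ShannonBoolean

/-- `ℝⁿ` with its Euclidean norm and Lebesgue measure. -/
abbrev Space (n : ℕ) : Type := EuclideanSpace ℝ (Fin n)

/-! ### Large deviations -/

/-- A good rate function on `ℝ`: lower semicontinuous, with compact sublevel sets. -/
structure IsGoodRate (I : ℝ → ℝ≥0∞) : Prop where
  lsc : LowerSemicontinuous I
  compact_sublevel : ∀ a : ℝ≥0, IsCompact {x : ℝ | I x ≤ a}

/-- The large deviations principle with speed `n` and rate function `I` for a sequence of
probability measures on `ℝ`; the logarithms take values in `[-∞, ∞]`. -/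
structure SatisfiesLDP (μ : ℕ → Measure ℝ) (I : ℝ → ℝ≥0∞) : Prop where
  lower : ∀ O : Set ℝ, IsOpen O →
    -((⨅ x ∈ O, I x : ℝ≥0∞) : EReal) ≤
      liminf (fun n : ℕ => ENNReal.log (μ n O) / (n : EReal)) atTop
  upper : ∀ C : Set ℝ, IsClosed C →
    limsup (fun n : ℕ => ENNReal.log (μ n C) / (n : EReal)) atTop ≤
      -((⨅ x ∈ C, I x : ℝ≥0∞) : EReal)

/-! ### Marked Poisson processes -/

variable {Ω : Type*} [MeasurableSpace Ω]

/-- The counting measure of the points `T 0 ω, T 1 ω, …`. -/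
def pointMeasure {n : ℕ} (T : ℕ → Ω → Space n) (ω : Ω) : Measure (Space n) :=
  Measure.sum fun k => Measure.dirac (T k ω)

/-- The (enumerated) random points `T k` form a homogeneous Poisson process on `ℝⁿ` with
intensity `lam`: the number of points in a bounded Borel set `B` is Poisson with mean
`lam * vol B`, and the numbers of points in disjoint bounded Borel sets are independent. -/
structure IsPoissonProcess {n : ℕ} (P : Measure Ω) (T : ℕ → Ω → Space n) (lam : ℝ≥0) :
    Prop where
  measurable : ∀ k, Measurable (T k)
  poisson : ∀ B : Set (Space n), MeasurableSet B → Bornology.IsBounded B →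
    P.map (fun ω => pointMeasure T ω B) =
      (poissonMeasure (lam * (volume B).toNNReal)).map (fun j : ℕ => (j : ℝ≥0∞))
  indep : ∀ (m : ℕ) (B : Fin m → Set (Space n)), (∀ i, MeasurableSet (B i)) →
    (∀ i, Bornology.IsBounded (B i)) → Pairwise (fun i j => Disjoint (B i) (B j)) →
    iIndepFun (fun i ω => pointMeasure T ω (B i)) P

/-- The points `T k` form a Poisson process with intensity `lam`; the marks `X k` are
i.i.d., distributed like `Xbar`, and independent of the points. -/
structure IsMarkedPoissonProcess {n : ℕ} (P : Measure Ω) (T : ℕ → Ω → Space n)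
    (X : ℕ → Ω → ℝ≥0) (Xbar : Ω → ℝ≥0) (lam : ℝ≥0) : Prop where
  points : IsPoissonProcess P T lam
  marks_measurable : ∀ k, Measurable (X k)
  marks_indep : iIndepFun X P
  marks_law : ∀ k, IdentDistrib (X k) Xbar P P
  marks_indep_points : IndepFun (fun ω k => X k ω) (fun ω k => T k ω) P

/-! ### Palm probability -/

/-- A configuration of marked points of `ℝⁿ`, as a measure on `ℝⁿ × ℝ⁺`
(the sum of the unit masses at the marked points). -/
abbrev Config (n : ℕ) : Type := Measure (Space n × ℝ≥0)

/-- The marked point configuration, seen from its `k`-th point (which is moved to the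
origin). -/
def configFrom {n : ℕ} (T : ℕ → Ω → Space n) (X : ℕ → Ω → ℝ≥0) (k : ℕ) (ω : Ω) :
    Config n :=
  Measure.sum fun l => Measure.dirac (T l ω - T k ω, X l ω)

theorem measurable_configFrom {n : ℕ} {T : ℕ → Ω → Space n} {X : ℕ → Ω → ℝ≥0}
    (hT : ∀ k, Measurable (T k)) (hX : ∀ k, Measurable (X k)) (k : ℕ) :
    Measurable (configFrom T X k) := by
  refine Measure.measurable_of_measurable_coe _ fun s hs => ?_
  simp only [configFrom, Measure.sum_apply _ hs]
  refine Measurable.tsum fun l => ?_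
  exact (Measure.measurable_coe hs).comp
    (Measure.measurable_dirac.comp (((hT l).sub (hT k)).prodMk (hX l)))

/-- The unit cube `[0, 1)ⁿ`. -/
def unitCube (n : ℕ) : Set (Space n) := {t | ∀ i, t i ∈ Ico (0 : ℝ) 1}

/-- The Palm probability of a stationary marked point process with intensity `lam`:
`P⁰(A) = lam⁻¹ * E [ #{k | T k ∈ [0, 1)ⁿ, the configuration seen from T k lies in A} ]`. -/
def palm {n : ℕ} (P : Measure Ω) (T : ℕ → Ω → Space n) (X : ℕ → Ω → ℝ≥0) (lam : ℝ≥0) :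
    Measure (Config n) :=
  (lam : ℝ≥0∞)⁻¹ •
    Measure.sum fun k => (P.restrict {ω | T k ω ∈ unitCube n}).map (configFrom T X k)

/-- The mark of the point at the origin (Palm-almost surely there is exactly one point
there, so the integral over the points at the origin picks its mark). -/
def originMark {n : ℕ} (φ : Config n) : ℝ≥0 :=
  (∫⁻ z in {z : Space n × ℝ≥0 | z.1 = 0}, (z.2 : ℝ≥0∞) ∂φ).toNNReal

/-- The degree `D_n` of the origin: the number of points other than the origin whose ball
meets the ball of the point at the origin, a point with mark `x` carrying the closed ball of
radius `x √n`. -/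
def degree {n : ℕ} (φ : Config n) : ℝ≥0∞ :=
  φ {z | z.1 ≠ 0 ∧
    (Metric.closedBall z.1 ((z.2 : ℝ) * √(n : ℝ)) ∩
      Metric.closedBall (0 : Space n) ((originMark φ : ℝ) * √(n : ℝ))).Nonempty}

/-- The mean degree of the origin under the Palm probability. -/
def meanDegree {n : ℕ} (P : Measure Ω) (T : ℕ → Ω → Space n) (X : ℕ → Ω → ℝ≥0)
    (lam : ℝ≥0) : ℝ≥0∞ :=
  ∫⁻ φ, degree φ ∂(palm P T X lam)

/-- The degree threshold
`τ_d = - (1/2) log (2 π e) + inf_{R ≥ 2 R*} (2 I(R/2) - log R)`, in `[-∞, ∞]`. -/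
def degreeThreshold (I : ℝ → ℝ≥0∞) (Rstar : ℝ) : EReal :=
  ((-(1 / 2) * Real.log (2 * Real.pi * Real.exp 1) : ℝ) : EReal) +
    ⨅ R ∈ Ici (2 * Rstar), (2 * (I (R / 2) : EReal) - ((Real.log R : ℝ) : EReal))

end ShannonBoolean

end

namespace ShannonBoolean

/-! ### Moments of the Poisson distribution -/

/-! Seen from a typical point, the other points still form a Poisson process, and a point at `t`
with mark `y` meets the origin's ball exactly when `‖t‖ ≤ (x + y) √n`, where `x` is the origin's
mark. Hence the mean degree is the intensity times the volume of the ball of radius `√n` times `E[(X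
+ X')^n]`, with `X`, `X'` independent copies of the mark (`meanDegree_eq`, `volume_ball_mul_sqrt`).
The Palm computation rests on the second moment measure of the points off the diagonal
(`pairMeasure_eq`), together with the independence of marks and points (`tsum_measure_eq`).

The three factors have exponential rates. The intensity gives `ρ`, and Stirling's formula gives
`(1/2) log (2πe)` for the volume (`hasExpRate_sqrtBallVolume`). The third factor is a Laplace
asymptotic. Two marks near `x` and `y` contribute `(x + y)^n exp (-n (I x + I y))`. Convexity gives
`I x + I y ≥ 2 I ((x + y) / 2)`, so equal marks are the cheapest way to reach a given sum. Sums
below `2 R*` are dominated by `2 R*` itself, because `I R* = 0` (`rate_eq_zero`) and the logarithm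
increases. What remains is the supremum of `log R - 2 I (R / 2)` over `R ≥ 2 R*`.

The moment condition enters through `exists_tail_le`. It discards large marks in the upper bound,
supplies the uniform integrability behind `I R* = 0`, and forces `I` to grow at least
logarithmically, so that the infimum is finite (`exists_lower_bound`). The rates add up, and the
sign of `ρ - τ` decides between decay and growth. -/

theorem poissonMeasure_singleton_succ (a : ℝ≥0) (j : ℕ) :
    ((j + 1 : ℕ) : ℝ≥0∞) * poissonMeasure a {j + 1} = a * poissonMeasure a {j} := by
  rw [poissonMeasure_singleton, poissonMeasure_singleton, ← ENNReal.ofReal_natCast,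
    ← ENNReal.ofReal_coe_nnreal, ← ENNReal.ofReal_mul (by positivity),
    ← ENNReal.ofReal_mul (by positivity)]
  congr 1
  rw [Nat.factorial_succ]
  push_cast
  field_simp
  ring

theorem tsum_poissonMeasure_singleton (a : ℝ≥0) : ∑' j, poissonMeasure a {j} = 1 := by
  have h := lintegral_countable' (μ := poissonMeasure a) (fun _ => 1)
  simpa using h.symm

theorem lintegral_natCast_poissonMeasure (a : ℝ≥0) :
    ∫⁻ j : ℕ, (j : ℝ≥0∞) ∂(poissonMeasure a) = a := by
  rw [lintegral_countable', tsum_eq_zero_add' ENNReal.summable]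
  simp only [poissonMeasure_singleton_succ, ENNReal.tsum_mul_left, tsum_poissonMeasure_singleton]
  simp

/-- Two steps of the recursion between consecutive weights each gain a factor `a`. The quadratic
order is what excludes coincident points: squares of the masses of small cells sum to something
small. -/
theorem poissonMeasure_two_le (a : ℝ≥0) : poissonMeasure a {j | 2 ≤ j} ≤ (a : ℝ≥0∞) ^ 2 := by
  have h2 (j : ℕ) : poissonMeasure a {j + 2} ≤ (a : ℝ≥0∞) ^ 2 * poissonMeasure a {j} := by
    have hle (i : ℕ) : poissonMeasure a {i + 1} ≤ a * poissonMeasure a {i} := by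
      rw [← poissonMeasure_singleton_succ]
      exact le_mul_of_one_le_left zero_le (by exact_mod_cast Nat.succ_pos i)
    calc poissonMeasure a {j + 1 + 1} ≤ a * poissonMeasure a {j + 1} := hle _
      _ ≤ a * (a * poissonMeasure a {j}) := by gcongr; exact hle j
      _ = _ := by ring
  calc poissonMeasure a {j | 2 ≤ j} = poissonMeasure a (⋃ j : ℕ, {j + 2}) := by
        congr 1; ext j
        simp only [mem_ofPred_eq, mem_iUnion, mem_singleton_iff]
        exact ⟨fun h => ⟨j - 2, by omega⟩, fun ⟨i, hi⟩ => by omega⟩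
    _ ≤ ∑' j : ℕ, poissonMeasure a {j + 2} := measure_iUnion_le _
    _ ≤ ∑' j : ℕ, (a : ℝ≥0∞) ^ 2 * poissonMeasure a {j} := ENNReal.tsum_le_tsum h2
    _ = _ := by rw [ENNReal.tsum_mul_left, tsum_poissonMeasure_singleton, mul_one]

/-! ### First and second moment measures of a Poisson process -/

theorem pointMeasure_apply {Ω : Type*} {n : ℕ} (T : ℕ → Ω → Space n) (ω : Ω)
    {B : Set (Space n)} (hB : MeasurableSet B) : pointMeasure T ω B = ∑' k, B.indicator 1 (T k ω) := by
  simp [pointMeasure, Measure.sum_apply _ hB, Measure.dirac_apply' _ hB]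

theorem two_le_pointMeasure {Ω : Type*} {n : ℕ} {T : ℕ → Ω → Space n} {ω : Ω}
    {B : Set (Space n)} (hB : MeasurableSet B) {k l : ℕ}
    (hkl : k ≠ l) (hk : T k ω ∈ B) (hl : T l ω ∈ B) : 2 ≤ pointMeasure T ω B := by
  rw [pointMeasure_apply _ _ hB]
  refine le_trans ?_ (ENNReal.sum_le_tsum {k, l})
  rw [Finset.sum_pair hkl]
  simp [hk, hl, one_add_one_eq_two]

section Points

variable {Ω : Type*} [MeasurableSpace Ω] {P : Measure Ω} {n : ℕ}
  {T : ℕ → Ω → Space n} {lam : ℝ≥0}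

theorem measurable_pointMeasure (hT : ∀ k, Measurable (T k)) {B : Set (Space n)}
    (hB : MeasurableSet B) : Measurable fun ω => pointMeasure T ω B := by
  simp only [pointMeasure_apply _ _ hB]
  exact Measurable.tsum fun k => (measurable_one.indicator hB).comp (hT k)

theorem coe_mul_toNNReal_volume {B : Set (Space n)} (hb : Bornology.IsBounded B) :
    ((lam * (volume B).toNNReal : ℝ≥0) : ℝ≥0∞) = lam * volume B := by
  rw [ENNReal.coe_mul, ENNReal.coe_toNNReal hb.measure_lt_top.ne]

theorem IsPoissonProcess.lintegral_pointMeasure (h : IsPoissonProcess P T lam)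
    {B : Set (Space n)} (hB : MeasurableSet B) (hb : Bornology.IsBounded B) :
    ∫⁻ ω, pointMeasure T ω B ∂P = lam * volume B := by
  have h1 := lintegral_map (μ := P) (f := fun x : ℝ≥0∞ => x) measurable_id
    (measurable_pointMeasure h.measurable hB)
  rw [← h1, h.poisson B hB hb, lintegral_map (f := fun x : ℝ≥0∞ => x) measurable_id .of_discrete,
    lintegral_natCast_poissonMeasure, coe_mul_toNNReal_volume hb]

theorem IsPoissonProcess.measure_two_le (h : IsPoissonProcess P T lam)
    {B : Set (Space n)} (hB : MeasurableSet B) (hb : Bornology.IsBounded B) :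
    P {ω | 2 ≤ pointMeasure T ω B} ≤ (lam * volume B) ^ 2 := by
  have h1 : P {ω | 2 ≤ pointMeasure T ω B} =
      P.map (fun ω => pointMeasure T ω B) (Ici 2) :=
    (Measure.map_apply (measurable_pointMeasure h.measurable hB) measurableSet_Ici).symm
  rw [h1, h.poisson B hB hb, Measure.map_apply .of_discrete measurableSet_Ici,
    ← coe_mul_toNNReal_volume hb]
  refine le_trans (measure_mono fun j hj => ?_) (poissonMeasure_two_le _)
  simpa using hj

theorem exists_volume_ball_le (hn : n ≠ 0) {ε : ℝ≥0∞} (hε : ε ≠ 0) :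
    ∃ δ : ℝ, 0 < δ ∧ ∀ x : Space n, volume (Metric.ball x δ) ≤ ε := by
  have : Nonempty (Fin n) := ⟨⟨0, Nat.pos_of_ne_zero hn⟩⟩
  have h : Tendsto (fun δ : ℝ => volume (Metric.ball (0 : Space n) δ)) (𝓝[>] 0) (𝓝 0) := by
    simp only [EuclideanSpace.volume_ball]
    have h1 : Tendsto (fun δ : ℝ => ENNReal.ofReal δ ^ Fintype.card (Fin n)) (𝓝[>] 0) (𝓝 0) := by
      have h2 : Tendsto (fun δ : ℝ => ENNReal.ofReal δ ^ Fintype.card (Fin n)) (𝓝 0)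
          (𝓝 (ENNReal.ofReal 0 ^ Fintype.card (Fin n))) :=
        (ENNReal.continuous_pow _).continuousAt.tendsto.comp
          (ENNReal.continuous_ofReal.tendsto 0)
      simp only [ENNReal.ofReal_zero, Fintype.card_fin, zero_pow hn] at h2
      simpa using h2.mono_left nhdsWithin_le_nhds
    simpa using ENNReal.Tendsto.mul_const (b := ENNReal.ofReal
      (√Real.pi ^ Fintype.card (Fin n) / Real.Gamma (Fintype.card (Fin n) / 2 + 1))) h1
      (Or.inr ENNReal.ofReal_ne_top)
  obtain ⟨δ, hδ, hδ0⟩ := ((h.eventually (eventually_le_nhds (pos_iff_ne_zero.2 hε))).and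
    self_mem_nhdsWithin).exists
  refine ⟨δ, hδ0, fun x => ?_⟩
  rwa [EuclideanSpace.volume_ball, ← EuclideanSpace.volume_ball (x := 0)]

/-- Coincident points put two points in the same cell of any partition. For cells of volume at most
`ε` the union bound costs the sum of `(lam * vol)^2`, which is at most `ε` times a fixed finite
number. -/
theorem IsPoissonProcess.measure_eq_mem_ball (hn : n ≠ 0) (h : IsPoissonProcess P T lam)
    {k l : ℕ} (hkl : k ≠ l) (r : ℝ) :
    P {ω | T k ω = T l ω ∧ T k ω ∈ Metric.ball 0 r} = 0 := by
  set Q : Set (Space n) := Metric.ball 0 r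
  have hQ : MeasurableSet Q := measurableSet_ball
  have hQb : Bornology.IsBounded Q := Metric.isBounded_ball
  have hfin : (lam : ℝ≥0∞) ^ 2 * volume Q ≠ ⊤ :=
    ENNReal.mul_ne_top (by simp) hQb.measure_lt_top.ne
  have key (ε : ℝ≥0∞) (hε : ε ≠ 0) :
      P {ω | T k ω = T l ω ∧ T k ω ∈ Q} ≤ ε * (lam ^ 2 * volume Q) := by
    obtain ⟨δ, hδ, hball⟩ := exists_volume_ball_le hn hε
    let u := TopologicalSpace.denseSeq (Space n)
    -- Balls of radius `δ` around a dense sequence cover the space; disjointing them gives a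
    -- countable partition into cells of volume at most `ε`.
    let D := disjointed fun j => Metric.ball (u j) δ
    have hD : ∀ j, MeasurableSet (D j) := MeasurableSet.disjointed fun j => measurableSet_ball
    have hcover : ⋃ j, D j = univ := by
      rw [iUnion_disjointed, eq_univ_iff_forall]
      intro x
      obtain ⟨j, hj⟩ := (TopologicalSpace.denseRange_denseSeq (Space n)).exists_dist_lt x hδ
      exact mem_iUnion.2 ⟨j, hj⟩
    have hDQ (j : ℕ) : volume (Q ∩ D j) ≤ ε :=
      (measure_mono (inter_subset_right.trans (disjointed_subset _ j))).trans (hball _)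
    calc P {ω | T k ω = T l ω ∧ T k ω ∈ Q}
        ≤ P (⋃ j, {ω | 2 ≤ pointMeasure T ω (Q ∩ D j)}) := by
          refine measure_mono fun ω hω => ?_
          obtain ⟨j, hj⟩ := mem_iUnion.1 (hcover.symm ▸ mem_univ (T k ω))
          exact mem_iUnion.2 ⟨j, two_le_pointMeasure (hQ.inter (hD j)) hkl ⟨hω.2, hj⟩
            (hω.1 ▸ ⟨hω.2, hj⟩)⟩
      _ ≤ ∑' j, P {ω | 2 ≤ pointMeasure T ω (Q ∩ D j)} := measure_iUnion_le _
      _ ≤ ∑' j, (lam * volume (Q ∩ D j)) ^ 2 := ENNReal.tsum_le_tsum fun j =>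
          h.measure_two_le (hQ.inter (hD j)) (hQb.subset inter_subset_left)
      _ ≤ ∑' j, ε * (lam ^ 2 * volume (Q ∩ D j)) := by
          refine ENNReal.tsum_le_tsum fun j => ?_
          calc (lam * volume (Q ∩ D j)) ^ 2
              = volume (Q ∩ D j) * (lam ^ 2 * volume (Q ∩ D j)) := by ring
            _ ≤ _ := by gcongr; exact hDQ j
      _ = ε * (lam ^ 2 * volume Q) := by
          rw [ENNReal.tsum_mul_left, ENNReal.tsum_mul_left, ← measure_iUnion
            (fun i j hij => (disjoint_disjointed _ hij).mono inter_subset_right inter_subset_right)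
            (fun j => hQ.inter (hD j)), ← inter_iUnion, hcover, inter_univ]
  have hlim : Tendsto (fun ε : ℝ≥0∞ => ε * (lam ^ 2 * volume Q)) (𝓝[>] 0) (𝓝 0) := by
    have := ENNReal.Tendsto.mul_const (b := (lam : ℝ≥0∞) ^ 2 * volume Q)
      (tendsto_id (α := ℝ≥0∞) (x := 𝓝 0)) (Or.inr hfin)
    simp only [id, zero_mul] at this
    exact this.mono_left nhdsWithin_le_nhds
  refine le_antisymm (ge_of_tendsto hlim ?_) zero_le
  filter_upwards [self_mem_nhdsWithin] with ε hε using key ε (ne_of_gt hε)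

/-- The points of a Poisson process are almost surely distinct. -/
theorem IsPoissonProcess.ae_injective (hn : n ≠ 0) (h : IsPoissonProcess P T lam) :
    ∀ᵐ ω ∂P, Function.Injective fun k => T k ω := by
  have h1 : ∀ᵐ ω ∂P, ∀ k l : ℕ, ∀ r : ℕ, k ≠ l →
      ¬ (T k ω = T l ω ∧ T k ω ∈ Metric.ball 0 (r : ℝ)) := by
    simp only [ae_all_iff]
    intro k l r hkl
    rw [ae_iff]
    simpa using h.measure_eq_mem_ball hn hkl r
  filter_upwards [h1] with ω hω k l hkl
  by_contra hne
  obtain ⟨r, hr⟩ := exists_nat_gt ‖T k ω‖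
  exact hω k l r hne ⟨hkl, by simpa using hr⟩

/-- The second moment measure of the points, restricted to pairs of distinct points. -/
noncomputable def pairMeasure (P : Measure Ω) (T : ℕ → Ω → Space n) :
    Measure (Space n × Space n) :=
  (Measure.sum fun p : ℕ × ℕ => P.map fun ω => (T p.1 ω, T p.2 ω)).restrict (diagonal _)ᶜ

theorem sum_map_prod_apply (hT : ∀ k, Measurable (T k)) {B C : Set (Space n)}
    (hB : MeasurableSet B) (hC : MeasurableSet C) :
    (Measure.sum fun p : ℕ × ℕ => P.map fun ω => (T p.1 ω, T p.2 ω)) (B ×ˢ C) =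
      ∫⁻ ω, pointMeasure T ω B * pointMeasure T ω C ∂P := by
  rw [Measure.sum_apply _ (hB.prod hC)]
  have h1 (ω : Ω) : pointMeasure T ω B * pointMeasure T ω C =
      ∑' p : ℕ × ℕ, {ω | T p.1 ω ∈ B ∧ T p.2 ω ∈ C}.indicator 1 ω := by
    rw [pointMeasure_apply _ _ hB, pointMeasure_apply _ _ hC, ENNReal.tsum_prod',
      ← ENNReal.tsum_mul_right]
    refine tsum_congr fun k => ?_
    rw [← ENNReal.tsum_mul_left]
    refine tsum_congr fun l => ?_
    by_cases hk : T k ω ∈ B <;> by_cases hl : T l ω ∈ C <;> simp [hk, hl, indicator]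
  have h2 (p : ℕ × ℕ) : MeasurableSet {ω | T p.1 ω ∈ B ∧ T p.2 ω ∈ C} :=
    (hT p.1 hB).inter (hT p.2 hC)
  simp only [h1]
  rw [lintegral_tsum fun p => (measurable_one.indicator (h2 p)).aemeasurable]
  refine tsum_congr fun p => ?_
  rw [lintegral_indicator_one (h2 p), Measure.map_apply ((hT _).prodMk (hT _)) (hB.prod hC)]
  rfl

theorem IsPoissonProcess.lintegral_mul (h : IsPoissonProcess P T lam) {B C : Set (Space n)}
    (hB : MeasurableSet B) (hC : MeasurableSet C) (hBb : Bornology.IsBounded B)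
    (hCb : Bornology.IsBounded C) (hBC : Disjoint B C) :
    ∫⁻ ω, pointMeasure T ω B * pointMeasure T ω C ∂P = lam * volume B * (lam * volume C) := by
  have hind := h.indep 2 ![B, C] (by simp [Fin.forall_fin_two, hB, hC])
    (by simp [Fin.forall_fin_two, hBb, hCb]) (by
      intro i j hij
      fin_cases i <;> fin_cases j <;> simp_all [disjoint_comm])
  have h01 := hind.indepFun (i := 0) (j := 1) (by simp)
  rw [← h.lintegral_pointMeasure hB hBb, ← h.lintegral_pointMeasure hC hCb]
  exact lintegral_mul_eq_lintegral_mul_lintegral_of_indepFun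
    (measurable_pointMeasure h.measurable hB) (measurable_pointMeasure h.measurable hC) h01

/-- Independence of counts applies only to disjoint bounded sets, so the product formula is
available only on products of disjoint balls. Countably many of these exhaust the complement of the
diagonal, and measures that agree on each of them agree there. -/
theorem exists_disjoint_balls_cover :
    ∃ (ι : Type) (_ : Countable ι) (x y : ι → Space n) (r : ι → ℝ),
      (∀ i, Disjoint (Metric.ball (x i) (r i)) (Metric.ball (y i) (r i))) ∧
      ⋃ i, Metric.ball (x i) (r i) ×ˢ Metric.ball (y i) (r i) = (diagonal (Space n))ᶜ := by
  let u := TopologicalSpace.denseSeq (Space n)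
  let r (m : ℕ) : ℝ := 1 / (m + 1)
  refine ⟨{p : ℕ × ℕ × ℕ // Disjoint (Metric.ball (u p.1) (r p.2.2))
    (Metric.ball (u p.2.1) (r p.2.2))}, inferInstance, fun p => u p.1.1, fun p => u p.1.2.1,
    fun p => r p.1.2.2, fun p => p.2, ?_⟩
  ext ⟨a, b⟩
  simp only [mem_iUnion, mem_prod, mem_compl_iff, mem_diagonal_iff]
  constructor
  · rintro ⟨p, ha, hb⟩ rfl
    exact disjoint_left.1 p.2 ha hb
  · intro hab
    have hd : 0 < dist a b := dist_pos.2 hab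
    obtain ⟨m, hm⟩ := exists_nat_one_div_lt (show 0 < dist a b / 4 by positivity)
    have hr : 0 < r m := by positivity
    obtain ⟨i, hi⟩ := (TopologicalSpace.denseRange_denseSeq (Space n)).exists_dist_lt a hr
    obtain ⟨j, hj⟩ := (TopologicalSpace.denseRange_denseSeq (Space n)).exists_dist_lt b hr
    refine ⟨⟨(i, j, m), Metric.ball_disjoint_ball ?_⟩, hi, hj⟩
    have h1 := dist_triangle4 a (u i) (u j) b
    rw [dist_comm (u j) b] at h1
    have hm' : r m < dist a b / 4 := hm
    change r m + r m ≤ dist (u i) (u j)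
    change dist a (u i) < _ at hi
    change dist b (u j) < _ at hj
    linarith

theorem volume_diagonal (hn : n ≠ 0) :
    ((volume : Measure (Space n)).prod volume) (diagonal (Space n)) = 0 := by
  have : Nonempty (Fin n) := ⟨⟨0, Nat.pos_of_ne_zero hn⟩⟩
  rw [Measure.measure_prod_null measurableSet_diagonal]
  refine Eventually.of_forall fun x => ?_
  have : Prod.mk x ⁻¹' diagonal (Space n) = {x} := by ext; simp [eq_comm]
  simp [this]

/-- On a product of disjoint balls, independence factorizes the second moment into two first
moments, and rectangles determine the measure. The diagonal is Lebesgue-null, so nothing is lost by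
removing it on the right. -/
theorem IsPoissonProcess.pairMeasure_eq (hn : n ≠ 0) (h : IsPoissonProcess P T lam) :
    pairMeasure P T = (((lam : ℝ≥0∞) ^ 2) • (volume : Measure (Space n)).prod volume) := by
  have hae : ((lam : ℝ≥0∞) ^ 2 • (volume : Measure (Space n)).prod volume) =
      ((lam : ℝ≥0∞) ^ 2 • (volume : Measure (Space n)).prod volume).restrict (diagonal _)ᶜ := by
    rw [Measure.restrict_eq_self_of_ae_mem]
    rw [ae_iff]
    simp [Measure.smul_apply, volume_diagonal hn, ← diagonal.eq_1]
  rw [hae, pairMeasure]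
  obtain ⟨ι, hι, x, y, r, hdisj, hcover⟩ := exists_disjoint_balls_cover (n := n)
  rw [← hcover, Measure.restrict_iUnion_congr]
  intro i
  set U := Metric.ball (x i) (r i)
  set V := Metric.ball (y i) (r i)
  have hU : MeasurableSet U := measurableSet_ball
  have hV : MeasurableSet V := measurableSet_ball
  have h1 : (((lam : ℝ≥0∞) • (volume : Measure (Space n))).restrict U).prod
      (((lam : ℝ≥0∞) • (volume : Measure (Space n))).restrict V) =
      ((lam : ℝ≥0∞) ^ 2 • (volume : Measure (Space n)).prod volume).restrict (U ×ˢ V) := by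
    rw [Measure.prod_restrict, Measure.prod_smul_left, Measure.prod_smul_right, smul_smul, sq]
  rw [← h1]
  have : IsFiniteMeasure (((lam : ℝ≥0∞) • (volume : Measure (Space n))).restrict U) := by
    rw [isFiniteMeasure_restrict, Measure.smul_apply, smul_eq_mul]
    exact ENNReal.mul_ne_top (by simp) Metric.isBounded_ball.measure_lt_top.ne
  have : IsFiniteMeasure (((lam : ℝ≥0∞) • (volume : Measure (Space n))).restrict V) := by
    rw [isFiniteMeasure_restrict, Measure.smul_apply, smul_eq_mul]
    exact ENNReal.mul_ne_top (by simp) Metric.isBounded_ball.measure_lt_top.ne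
  refine (Measure.prod_eq fun B C hB hC => ?_).symm
  rw [Measure.restrict_apply (hB.prod hC), prod_inter_prod,
    sum_map_prod_apply h.measurable (hB.inter hU) (hC.inter hV),
    h.lintegral_mul (hB.inter hU) (hC.inter hV) (Metric.isBounded_ball.subset inter_subset_right)
      (Metric.isBounded_ball.subset inter_subset_right)
      ((hdisj i).mono inter_subset_right inter_subset_right),
    Measure.restrict_apply hB, Measure.restrict_apply hC]
  simp

end Points

/-! ### The degree as a functional of the configuration -/

section Degree

variable {n : ℕ}

/-- The marked points whose closed ball meets the closed ball of radius `m √n` at the origin. -/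
def touching (n : ℕ) (m : ℝ≥0) : Set (Space n × ℝ≥0) :=
  {z | z.1 ≠ 0 ∧ ‖z.1‖ ≤ ((z.2 : ℝ) + m) * √(n : ℝ)}

/-- The marked points whose open ball meets the open ball of radius `m √n` at the origin. -/
def overlapping (n : ℕ) (m : ℝ≥0) : Set (Space n × ℝ≥0) :=
  {z | z.1 ≠ 0 ∧ ‖z.1‖ < ((z.2 : ℝ) + m) * √(n : ℝ)}

theorem measurableSet_touching (m : ℝ≥0) : MeasurableSet (touching n m) := by
  refine ((measurableSet_singleton 0).preimage measurable_fst).compl.inter ?_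
  exact measurableSet_le (f := fun z : Space n × ℝ≥0 => ‖z.1‖)
    (g := fun z => ((z.2 : ℝ) + m) * √(n : ℝ)) (by fun_prop) (by fun_prop)

theorem measurableSet_overlapping (m : ℝ≥0) : MeasurableSet (overlapping n m) := by
  refine ((measurableSet_singleton 0).preimage measurable_fst).compl.inter ?_
  exact measurableSet_lt (f := fun z : Space n × ℝ≥0 => ‖z.1‖)
    (g := fun z => ((z.2 : ℝ) + m) * √(n : ℝ)) (by fun_prop) (by fun_prop)

theorem overlapping_subset_touching (m : ℝ≥0) : overlapping n m ⊆ touching n m :=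
  fun _ hz => ⟨hz.1, hz.2.le⟩

theorem overlapping_mono {m m' : ℝ≥0} (h : m ≤ m') : overlapping n m ⊆ overlapping n m' := by
  refine fun z hz => ⟨hz.1, hz.2.trans_le ?_⟩
  have : (m : ℝ) ≤ m' := h
  gcongr

theorem closedBall_inter_nonempty_iff {x : Space n} {r s : ℝ} (hr : 0 ≤ r) (hs : 0 ≤ s) :
    (Metric.closedBall x r ∩ Metric.closedBall 0 s).Nonempty ↔ ‖x‖ ≤ r + s := by
  rw [← not_disjoint_iff_nonempty_inter, disjoint_closedBall_closedBall_iff hr hs, not_lt,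
    dist_zero_right]

theorem degree_eq (φ : Config n) : degree φ = φ (touching n (originMark φ)) := by
  unfold degree touching
  congr 1
  ext z
  simp only [mem_ofPred_eq, add_mul]
  rw [closedBall_inter_nonempty_iff (by positivity) (by positivity)]

theorem measurable_originMark : Measurable (originMark : Config n → ℝ≥0) := by
  have hs : MeasurableSet {z : Space n × ℝ≥0 | z.1 = 0} :=
    (measurableSet_singleton 0).preimage measurable_fst
  unfold originMark
  simp only [← lintegral_indicator hs]
  exact (Measure.measurable_lintegral
    ((measurable_coe_nnreal_ennreal.comp measurable_snd).indicator hs)).ennreal_toNNReal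

/-- A strict inequality survives lowering the radius slightly, so rational radii suffice. Equality
`q = m` must be allowed to cover `m = 0`. -/
theorem overlapping_eq_iUnion (hn : n ≠ 0) (m : ℝ≥0) :
    overlapping n m = ⋃ q : {q : ℚ≥0 // (q : ℝ≥0) ≤ m}, overlapping n (q : ℚ≥0) := by
  refine subset_antisymm (fun z hz => ?_) (iUnion_subset fun q => overlapping_mono q.2)
  rcases eq_or_ne m 0 with rfl | hm
  · exact mem_iUnion.2 ⟨⟨0, by simp⟩, by simpa using hz⟩
  · have hs : 0 < √(n : ℝ) := by positivity
    have h1 : ‖z.1‖ / √(n : ℝ) - z.2 < m := by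
      have := (div_lt_iff₀ hs).2 hz.2
      linarith
    obtain ⟨q, hq1, hq2⟩ := exists_rat_btwn (max_lt h1 (show (0 : ℝ) < m by positivity))
    have hq0 : 0 ≤ q := by
      have : (0 : ℝ) < q := (le_max_right _ _).trans_lt hq1
      exact_mod_cast this.le
    lift q to ℚ≥0 using hq0
    have hqm : (q : ℝ≥0) ≤ m := by
      have : ((q : ℝ≥0) : ℝ) ≤ m := hq2.le
      exact this
    refine mem_iUnion.2 ⟨⟨q, hqm⟩, hz.1, ?_⟩
    rw [← div_lt_iff₀ hs]
    have := (le_max_left _ _).trans_lt hq1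
    have hq : ‖z.1‖ / √(n : ℝ) - z.2 < ((q : ℝ≥0) : ℝ) := this
    linarith

/-- The set being measured depends on the configuration through its mark; an increasing union over
rational radii turns its mass into a countable supremum of measurable functions. The closed version
would need a decreasing intersection, along which a possibly infinite measure need not be
continuous. This is why the degree is bounded below through open balls. -/
theorem measurable_apply_overlapping (hn : n ≠ 0) :
    Measurable fun φ : Config n => φ (overlapping n (originMark φ)) := by
  have h (φ : Config n) : φ (overlapping n (originMark φ)) =
      ⨆ q : ℚ≥0, {φ : Config n | (q : ℝ≥0) ≤ originMark φ}.indicator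
        (fun φ => φ (overlapping n q)) φ := by
    have hd : Directed (· ⊆ ·) fun q : {q : ℚ≥0 // (q : ℝ≥0) ≤ originMark φ} =>
        overlapping n ((q : ℚ≥0) : ℝ≥0) :=
      Monotone.directed_le (f := fun q : {q : ℚ≥0 // (q : ℝ≥0) ≤ originMark φ} =>
        overlapping n ((q : ℚ≥0) : ℝ≥0)) fun p q hpq =>
          overlapping_mono (by exact_mod_cast hpq)
    rw [overlapping_eq_iUnion hn, hd.measure_iUnion, iSup_subtype]
    refine iSup_congr fun q => ?_
    by_cases hq : (q : ℝ≥0) ≤ originMark φ <;> simp [hq]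
  simp only [h]
  exact Measurable.iSup fun q => (Measure.measurable_coe (measurableSet_overlapping _)).indicator
    (measurableSet_le measurable_const measurable_originMark)

end Degree

/-! ### The mean degree -/

theorem configFrom_apply {Ω : Type*} {n : ℕ} (T : ℕ → Ω → Space n) (X : ℕ → Ω → ℝ≥0) (k : ℕ)
    (ω : Ω) {s : Set (Space n × ℝ≥0)} (hs : MeasurableSet s) :
    configFrom T X k ω s = ∑' l, s.indicator 1 (T l ω - T k ω, X l ω) := by
  simp [configFrom, Measure.sum_apply _ hs, Measure.dirac_apply' _ hs]

theorem originMark_configFrom {Ω : Type*} {n : ℕ} {T : ℕ → Ω → Space n} (X : ℕ → Ω → ℝ≥0)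
    {ω : Ω} (hinj : Function.Injective fun k => T k ω) (k : ℕ) :
    originMark (configFrom T X k ω) = X k ω := by
  have hs : MeasurableSet {z : Space n × ℝ≥0 | z.1 = 0} :=
    (measurableSet_singleton 0).preimage measurable_fst
  have hm : Measurable ({z : Space n × ℝ≥0 | z.1 = 0}.indicator fun z => (z.2 : ℝ≥0∞)) :=
    (measurable_coe_nnreal_ennreal.comp measurable_snd).indicator hs
  rw [originMark, configFrom, ← lintegral_indicator hs, lintegral_sum_measure]
  simp only [lintegral_dirac' _ hm]
  rw [tsum_eq_single k]
  · simp
  · intro l hl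
    have : T l ω ≠ T k ω := fun he => hl (hinj he)
    simp [sub_eq_zero, this]


section MeanDegree

variable {Ω : Type*} [MeasurableSpace Ω] {P : Measure Ω} {n : ℕ}
  {T : ℕ → Ω → Space n} {X : ℕ → Ω → ℝ≥0} {Xbar : Ω → ℝ≥0} {lam : ℝ≥0}

theorem measurableSet_unitCube : MeasurableSet (unitCube n) := by
  have : unitCube n = ⋂ i, (fun t : Space n => t i) ⁻¹' Ico 0 1 := by
    ext; simp [unitCube]
  rw [this]
  exact MeasurableSet.iInter fun i => measurableSet_Ico.preimage (by fun_prop)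

theorem volume_unitCube : volume (unitCube n) = 1 := by
  have : unitCube n = (WithLp.ofLp : Space n → Fin n → ℝ) ⁻¹' (univ.pi fun _ => Ico 0 1) := by
    ext; simp [unitCube]
  rw [this, (PiLp.volume_preserving_ofLp (Fin n)).measure_preimage
    (MeasurableSet.univ_pi fun _ => measurableSet_Ico).nullMeasurableSet, volume_pi_pi]
  simp

variable [IsProbabilityMeasure P]

/-- The law of a pair of independent marks. -/
noncomputable def markPair (P : Measure Ω) (Xbar : Ω → ℝ≥0) : Measure (ℝ≥0 × ℝ≥0) :=
  (P.map Xbar).prod (P.map Xbar)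

theorem IsMarkedPoissonProcess.map_pair (h : IsMarkedPoissonProcess P T X Xbar lam) {k l : ℕ}
    (hkl : k ≠ l) :
    P.map (fun ω => ((T k ω, T l ω), (X k ω, X l ω))) =
      (P.map fun ω => (T k ω, T l ω)).prod (markPair P Xbar) := by
  have hT := h.points.measurable
  have hX := h.marks_measurable
  have h1 : IndepFun (fun ω => (T k ω, T l ω)) (fun ω => (X k ω, X l ω)) P :=
    (h.marks_indep_points.comp (φ := fun x : ℕ → ℝ≥0 => (x k, x l))
      (ψ := fun t : ℕ → Space n => (t k, t l)) (by fun_prop) (by fun_prop)).symm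
  rw [h1.map_prod_eq_prod_map_map ((hT k).prodMk (hT l)).aemeasurable
    ((hX k).prodMk (hX l)).aemeasurable,
    (h.marks_indep.indepFun hkl).map_prod_eq_prod_map_map (hX k).aemeasurable
      (hX l).aemeasurable, (h.marks_law k).map_eq, (h.marks_law l).map_eq, markPair]

/-- The second moment formula for a marked Poisson process. -/
theorem IsMarkedPoissonProcess.tsum_measure_eq (hn : n ≠ 0)
    (h : IsMarkedPoissonProcess P T X Xbar lam) {S : Set ((Space n × Space n) × (ℝ≥0 × ℝ≥0))}
    (hS : MeasurableSet S) (hdiag : ∀ t z, ((t, t), z) ∉ S) :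
    ∑' k, ∑' l, P {ω | ((T k ω, T l ω), (X k ω, X l ω)) ∈ S} =
      lam ^ 2 * (((volume : Measure (Space n)).prod volume).prod (markPair P Xbar)) S := by
  have hT := h.points.measurable
  have hX := h.marks_measurable
  have := Measure.isProbabilityMeasure_map (μ := P) (h.marks_law 0).aemeasurable_snd
  have : SFinite (markPair P Xbar) := by unfold markPair; infer_instance
  have hterm (p : ℕ × ℕ) : P {ω | ((T p.1 ω, T p.2 ω), (X p.1 ω, X p.2 ω)) ∈ S} =
      ∫⁻ t, markPair P Xbar (Prod.mk t ⁻¹' S)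
        ∂(P.map fun ω => (T p.1 ω, T p.2 ω)).restrict (diagonal (Space n))ᶜ := by
    rw [← lintegral_indicator measurableSet_diagonal.compl]
    -- The sections of `S` over the diagonal are empty, so restricting to its complement is free and
    -- the terms `k = l` vanish on both sides.
    have hind : (diagonal (Space n))ᶜ.indicator (fun t => markPair P Xbar (Prod.mk t ⁻¹' S)) =
        fun t => markPair P Xbar (Prod.mk t ⁻¹' S) := by
      refine indicator_eq_self.2 fun t ht htd => ht ?_
      obtain ⟨a, b⟩ := t
      obtain rfl : a = b := htd
      have : Prod.mk (a, a) ⁻¹' S = ∅ := by ext z; simp [hdiag]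
      simp [this]
    rw [hind]
    obtain ⟨k, l⟩ := p
    rcases eq_or_ne k l with rfl | hkl
    · have h0 (t : Space n) : Prod.mk (t, t) ⁻¹' S = ∅ := by ext z; simp [hdiag]
      rw [lintegral_map (measurable_measure_prodMk_left hS) ((hT k).prodMk (hT k))]
      simp [hdiag, h0]
    · rw [← Measure.prod_apply hS, ← h.map_pair hkl, Measure.map_apply
        (((hT k).prodMk (hT l)).prodMk ((hX k).prodMk (hX l))) hS]
      rfl
  rw [← ENNReal.tsum_prod (f := fun k l => P {ω | ((T k ω, T l ω), (X k ω, X l ω)) ∈ S})]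
  simp only [hterm]
  rw [← lintegral_sum_measure, ← Measure.restrict_sum _ measurableSet_diagonal.compl]
  change ∫⁻ t, _ ∂(pairMeasure P T) = _
  rw [h.points.pairMeasure_eq hn, lintegral_smul_measure, Measure.prod_apply hS, smul_eq_mul]

/-- The pairs of marked points, the first in the unit cube, related by `A`. -/
def cubePairs (A : ℝ≥0 → Set (Space n × ℝ≥0)) : Set ((Space n × Space n) × (ℝ≥0 × ℝ≥0)) :=
  {p | p.1.1 ∈ unitCube n ∧ (p.1.2 - p.1.1, p.2.2) ∈ A p.2.1}

/-- Since the points are almost surely distinct, the mark read at the origin is that of the `k`-th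
point. The integrand then counts pairs of marked points, and the second moment formula applies. -/
theorem IsMarkedPoissonProcess.lintegral_configFrom (hn : n ≠ 0)
    (h : IsMarkedPoissonProcess P T X Xbar lam) (A : ℝ≥0 → Set (Space n × ℝ≥0))
    (hA : ∀ m, MeasurableSet (A m)) (hA' : MeasurableSet (cubePairs A))
    (h0 : ∀ m x, ((0 : Space n), x) ∉ A m) :
    ∑' k, ∫⁻ ω in {ω | T k ω ∈ unitCube n},
      configFrom T X k ω (A (originMark (configFrom T X k ω))) ∂P =
      lam ^ 2 * (((volume : Measure (Space n)).prod volume).prod (markPair P Xbar))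
        (cubePairs A) := by
  have hT := h.points.measurable
  have hX := h.marks_measurable
  rw [← h.tsum_measure_eq hn hA' fun t z ht => h0 z.1 z.2 (by simpa using ht.2)]
  refine tsum_congr fun k => ?_
  have hcube : MeasurableSet {ω | T k ω ∈ unitCube n} := hT k measurableSet_unitCube
  have hmeas (l : ℕ) : MeasurableSet {ω | ((T k ω, T l ω), (X k ω, X l ω)) ∈ cubePairs A} :=
    (((hT k).prodMk (hT l)).prodMk ((hX k).prodMk (hX l))) hA'
  rw [← lintegral_indicator hcube]
  calc _ = ∫⁻ ω, ∑' l, {ω | ((T k ω, T l ω), (X k ω, X l ω)) ∈ cubePairs A}.indicator 1 ω ∂P := by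
        refine lintegral_congr_ae ?_
        filter_upwards [h.points.ae_injective hn] with ω hω
        by_cases hk : T k ω ∈ unitCube n
        · rw [indicator_of_mem (show ω ∈ {ω | T k ω ∈ unitCube n} from hk),
            originMark_configFrom X hω, configFrom_apply _ _ _ _ (hA _)]
          refine tsum_congr fun l => ?_
          by_cases hl : (T l ω - T k ω, X l ω) ∈ A (X k ω)
          · rw [indicator_of_mem hl, indicator_of_mem
              (show ω ∈ {ω | ((T k ω, T l ω), (X k ω, X l ω)) ∈ cubePairs A} from ⟨hk, hl⟩)]
            rfl
          · rw [indicator_of_notMem hl, indicator_of_notMem fun h => hl h.2]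
        · rw [indicator_of_notMem (show ω ∉ {ω | T k ω ∈ unitCube n} from hk)]
          simp [cubePairs, hk]
    _ = _ := by
        rw [lintegral_tsum fun l => (measurable_one.indicator (hmeas l)).aemeasurable]
        exact tsum_congr fun l => lintegral_indicator_one (hmeas l)

/-- By translation invariance the inner volume does not depend on the first point, which therefore
contributes only the volume `1` of the cube. -/
theorem prod_prod_cubePairs (hX : AEMeasurable Xbar P) {A : ℝ≥0 → Set (Space n × ℝ≥0)}
    (hA : MeasurableSet (cubePairs A)) :
    (((volume : Measure (Space n)).prod volume).prod (markPair P Xbar)) (cubePairs A) =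
      ∫⁻ z, volume {t : Space n | (t, z.2) ∈ A z.1} ∂(markPair P Xbar) := by
  have := Measure.isProbabilityMeasure_map (μ := P) hX
  have : SFinite (markPair P Xbar) := by unfold markPair; infer_instance
  rw [Measure.prod_apply_symm hA]
  refine lintegral_congr fun z => ?_
  rw [Measure.prod_apply (hA.preimage measurable_prodMk_right)]
  have h1 (s : Space n) : volume (Prod.mk s ⁻¹' ((fun p => (p, z)) ⁻¹' cubePairs A)) =
      (unitCube n).indicator (fun _ => volume {t : Space n | (t, z.2) ∈ A z.1}) s := by
    by_cases hs : s ∈ unitCube n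
    · rw [indicator_of_mem hs,
        ← measure_preimage_add_right volume (-s) {t : Space n | (t, z.2) ∈ A z.1}]
      congr 1
      ext t
      simp [cubePairs, hs, sub_eq_add_neg]
    · rw [indicator_of_notMem hs]
      have : Prod.mk s ⁻¹' ((fun p => (p, z)) ⁻¹' cubePairs A) = ∅ := by
        ext t; simp [cubePairs, hs]
      rw [this, measure_empty]
  simp only [h1]
  rw [lintegral_indicator measurableSet_unitCube]
  simp [volume_unitCube]

theorem measurableSet_cubePairs_touching : MeasurableSet (cubePairs (touching n)) := by
  have h1 : MeasurableSet {p : (Space n × Space n) × (ℝ≥0 × ℝ≥0) | p.1.1 ∈ unitCube n} :=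
    measurableSet_unitCube.preimage (by fun_prop)
  have h2 : MeasurableSet {p : (Space n × Space n) × (ℝ≥0 × ℝ≥0) | p.1.2 - p.1.1 = 0} :=
    (measurableSet_singleton 0).preimage (by fun_prop)
  refine h1.inter (h2.compl.inter ?_)
  exact measurableSet_le (f := fun p : (Space n × Space n) × (ℝ≥0 × ℝ≥0) => ‖p.1.2 - p.1.1‖)
    (g := fun p => ((p.2.2 : ℝ) + p.2.1) * √(n : ℝ)) (by fun_prop) (by fun_prop)

theorem measurableSet_cubePairs_overlapping : MeasurableSet (cubePairs (overlapping n)) := by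
  have h1 : MeasurableSet {p : (Space n × Space n) × (ℝ≥0 × ℝ≥0) | p.1.1 ∈ unitCube n} :=
    measurableSet_unitCube.preimage (by fun_prop)
  have h2 : MeasurableSet {p : (Space n × Space n) × (ℝ≥0 × ℝ≥0) | p.1.2 - p.1.1 = 0} :=
    (measurableSet_singleton 0).preimage (by fun_prop)
  refine h1.inter (h2.compl.inter ?_)
  exact measurableSet_lt (f := fun p : (Space n × Space n) × (ℝ≥0 × ℝ≥0) => ‖p.1.2 - p.1.1‖)
    (g := fun p => ((p.2.2 : ℝ) + p.2.1) * √(n : ℝ)) (by fun_prop) (by fun_prop)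

theorem volume_touching_le (hn : n ≠ 0) (x y : ℝ≥0) :
    volume {t : Space n | (t, y) ∈ touching n x} ≤
      volume (Metric.ball (0 : Space n) (((y : ℝ) + x) * √(n : ℝ))) := by
  have : Nonempty (Fin n) := ⟨⟨0, Nat.pos_of_ne_zero hn⟩⟩
  rw [← Measure.addHaar_closedBall_eq_addHaar_ball]
  exact measure_mono fun t ht => by simpa using ht.2

theorem le_volume_overlapping (hn : n ≠ 0) (x y : ℝ≥0) :
    volume (Metric.ball (0 : Space n) (((y : ℝ) + x) * √(n : ℝ))) ≤
      volume {t : Space n | (t, y) ∈ overlapping n x} := by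
  have : Nonempty (Fin n) := ⟨⟨0, Nat.pos_of_ne_zero hn⟩⟩
  rw [← measure_sdiff_null (measure_singleton (0 : Space n))]
  exact measure_mono fun t ht => ⟨by simpa using ht.2, by simpa using ht.1⟩

/-- The mean degree is the mean number of Poisson points in a ball whose radius is the sum of
two independent marks. -/
theorem IsMarkedPoissonProcess.meanDegree_eq (hn : n ≠ 0) (hlam : lam ≠ 0)
    (h : IsMarkedPoissonProcess P T X Xbar lam) :
    meanDegree P T X lam = lam * ∫⁻ z,
      volume (Metric.ball (0 : Space n) (((z.2 : ℝ) + z.1) * √(n : ℝ))) ∂(markPair P Xbar) := by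
  have hXbar := (h.marks_law 0).aemeasurable_snd
  have hconf (k : ℕ) := measurable_configFrom h.points.measurable h.marks_measurable k
  have hpalm (f : Config n → ℝ≥0∞) : ∫⁻ φ, f φ ∂(palm P T X lam) = (lam : ℝ≥0∞)⁻¹ *
      ∑' k, ∫⁻ φ, f φ ∂((P.restrict {ω | T k ω ∈ unitCube n}).map (configFrom T X k)) := by
    rw [palm, lintegral_smul_measure, lintegral_sum_measure, smul_eq_mul]
  have hmul (c : ℝ≥0∞) : (lam : ℝ≥0∞)⁻¹ * (lam ^ 2 * c) = lam * c := by
    rw [sq, ← mul_assoc, ← mul_assoc, ENNReal.inv_mul_cancel (by simpa) (by simp), one_mul]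
  -- The upper bound uses closed balls, where `lintegral_map_le` needs no measurability; the lower
  -- bound uses open balls, where measurability gives an equality. The two agree because spheres and
  -- the origin are null in positive dimension.
  refine le_antisymm ?_ ?_
  · calc meanDegree P T X lam
        = (lam : ℝ≥0∞)⁻¹ * ∑' k, ∫⁻ φ, φ (touching n (originMark φ))
          ∂((P.restrict {ω | T k ω ∈ unitCube n}).map (configFrom T X k)) := by
          rw [meanDegree, hpalm]
          simp only [degree_eq]
      _ ≤ (lam : ℝ≥0∞)⁻¹ * ∑' k, ∫⁻ ω in {ω | T k ω ∈ unitCube n},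
            configFrom T X k ω (touching n (originMark (configFrom T X k ω))) ∂P := by
          gcongr with k
          exact lintegral_map_le _ _
      _ = lam * ∫⁻ z, volume {t : Space n | (t, z.2) ∈ touching n z.1} ∂(markPair P Xbar) := by
          rw [h.lintegral_configFrom hn _ measurableSet_touching measurableSet_cubePairs_touching
            fun m x hx => hx.1 rfl, hmul, prod_prod_cubePairs hXbar
            measurableSet_cubePairs_touching]
      _ ≤ _ := by
          refine mul_le_mul_right (lintegral_mono fun z => ?_) _
          exact volume_touching_le hn _ _
  · calc lam * ∫⁻ z, volume (Metric.ball (0 : Space n) (((z.2 : ℝ) + z.1) * √(n : ℝ)))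
          ∂(markPair P Xbar)
        ≤ lam * ∫⁻ z, volume {t : Space n | (t, z.2) ∈ overlapping n z.1} ∂(markPair P Xbar) := by
          refine mul_le_mul_right (lintegral_mono fun z => ?_) _
          exact le_volume_overlapping hn _ _
      _ = (lam : ℝ≥0∞)⁻¹ * ∑' k, ∫⁻ ω in {ω | T k ω ∈ unitCube n},
            configFrom T X k ω (overlapping n (originMark (configFrom T X k ω))) ∂P := by
          rw [h.lintegral_configFrom hn _ measurableSet_overlapping
            measurableSet_cubePairs_overlapping fun m x hx => hx.1 rfl, hmul,
            prod_prod_cubePairs hXbar measurableSet_cubePairs_overlapping]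
      _ = (lam : ℝ≥0∞)⁻¹ * ∑' k, ∫⁻ φ, φ (overlapping n (originMark φ))
          ∂((P.restrict {ω | T k ω ∈ unitCube n}).map (configFrom T X k)) := by
          congr 1
          exact tsum_congr fun k =>
            (lintegral_map (measurable_apply_overlapping hn) (hconf k)).symm
      _ ≤ meanDegree P T X lam := by
          rw [meanDegree, hpalm]
          gcongr with k
          rw [degree_eq]
          exact measure_mono (overlapping_subset_touching _)

end MeanDegree

/-! ### Exponential growth rates -/

/-- The sequence `a n` grows like `exp (n L)` on the logarithmic scale. -/
def HasExpRate (a : ℕ → ℝ≥0∞) (L : ℝ) : Prop :=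
  ∀ ε > 0, ∀ᶠ n : ℕ in atTop, ENNReal.ofReal (Real.exp (n * (L - ε))) ≤ a n ∧
    a n ≤ ENNReal.ofReal (Real.exp (n * (L + ε)))

theorem HasExpRate.congr {a b : ℕ → ℝ≥0∞} {L : ℝ} (ha : HasExpRate a L) (hab : a =ᶠ[atTop] b) :
    HasExpRate b L := by
  intro ε hε
  filter_upwards [ha ε hε, hab] with n h1 h2
  rwa [← h2]

theorem HasExpRate.mul {a b : ℕ → ℝ≥0∞} {L M : ℝ} (ha : HasExpRate a L) (hb : HasExpRate b M) :
    HasExpRate (fun n => a n * b n) (L + M) := by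
  intro ε hε
  filter_upwards [ha (ε / 2) (half_pos hε), hb (ε / 2) (half_pos hε)] with n h1 h2
  have hlow : (n : ℝ) * (L + M - ε) = n * (L - ε / 2) + n * (M - ε / 2) := by ring
  have hupp : (n : ℝ) * (L + M + ε) = n * (L + ε / 2) + n * (M + ε / 2) := by ring
  rw [hlow, hupp, Real.exp_add, Real.exp_add, ENNReal.ofReal_mul (Real.exp_nonneg _),
    ENNReal.ofReal_mul (Real.exp_nonneg _)]
  exact ⟨mul_le_mul' h1.1 h2.1, mul_le_mul' h1.2 h2.2⟩

theorem hasExpRate_exp {f : ℕ → ℝ} {L : ℝ} (hf : Tendsto f atTop (𝓝 L)) :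
    HasExpRate (fun n => ENNReal.ofReal (Real.exp (n * f n))) L := by
  intro ε hε
  filter_upwards [hf.eventually (Icc_mem_nhds (sub_lt_self L hε) (lt_add_of_pos_right L hε))]
    with n hn
  exact ⟨by gcongr; exact hn.1, by gcongr; exact hn.2⟩

theorem log_ofReal_exp_div {n : ℕ} (hn : n ≠ 0) (c : ℝ) :
    ENNReal.log (ENNReal.ofReal (Real.exp (n * c))) / (n : EReal) = (c : EReal) := by
  have h0 : (n : ℝ) ≠ 0 := by exact_mod_cast hn
  rw [ENNReal.log_ofReal_of_pos (Real.exp_pos _), Real.log_exp,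
    show ((n : ℕ) : EReal) = ((n : ℝ) : EReal) from rfl, ← EReal.coe_div, mul_div_cancel_left₀ _ h0]

theorem HasExpRate.tendsto_log {a : ℕ → ℝ≥0∞} {L : ℝ} (ha : HasExpRate a L) :
    Tendsto (fun n : ℕ => ENNReal.log (a n) / (n : EReal)) atTop (𝓝 (L : EReal)) := by
  have key (ε : ℝ) (hε : 0 < ε) : ∀ᶠ n : ℕ in atTop,
      ((L - ε : ℝ) : EReal) ≤ ENNReal.log (a n) / (n : EReal) ∧
        ENNReal.log (a n) / (n : EReal) ≤ ((L + ε : ℝ) : EReal) := by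
    filter_upwards [ha ε hε, eventually_ne_atTop 0] with n hn h0
    rw [← log_ofReal_exp_div h0 (L - ε), ← log_ofReal_exp_div h0 (L + ε)]
    exact ⟨EReal.div_le_div_right_of_nonneg (by positivity) (ENNReal.log_monotone hn.1),
      EReal.div_le_div_right_of_nonneg (by positivity) (ENNReal.log_monotone hn.2)⟩
  refine tendsto_order.2 ⟨fun b hb => ?_, fun b hb => ?_⟩
  · obtain ⟨c, hbc, hcL⟩ := EReal.lt_iff_exists_real_btwn.1 hb
    have hcL' : c < L := by exact_mod_cast hcL
    filter_upwards [key (L - c) (sub_pos.2 hcL')] with n hn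
    rw [sub_sub_cancel] at hn
    exact hbc.trans_le hn.1
  · obtain ⟨c, hLc, hcb⟩ := EReal.lt_iff_exists_real_btwn.1 hb
    have hcL' : L < c := by exact_mod_cast hLc
    filter_upwards [key (c - L) (sub_pos.2 hcL')] with n hn
    rw [add_sub_cancel] at hn
    exact hn.2.trans_lt hcb

theorem HasExpRate.exists_le_of_neg {a : ℕ → ℝ≥0∞} {L : ℝ} (ha : HasExpRate a L) (hL : L < 0) :
    ∃ c : ℝ, 0 < c ∧ ∀ᶠ n : ℕ in atTop, a n ≤ ENNReal.ofReal (Real.exp (-(c * n))) := by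
  refine ⟨-L / 2, by linarith, ?_⟩
  filter_upwards [ha (-L / 2) (by linarith)] with n hn
  refine hn.2.trans_eq ?_
  congr 2
  ring

theorem HasExpRate.exists_ge_of_pos {a : ℕ → ℝ≥0∞} {L : ℝ} (ha : HasExpRate a L) (hL : 0 < L) :
    ∃ c : ℝ, 0 < c ∧ ∀ᶠ n : ℕ in atTop, ENNReal.ofReal (Real.exp (c * n)) ≤ a n := by
  refine ⟨L / 2, by linarith, ?_⟩
  filter_upwards [ha (L / 2) (by linarith)] with n hn
  refine hn.1.trans_eq' ?_
  congr 2
  ring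

theorem tendsto_ofReal_exp_neg {c : ℝ} (hc : 0 < c) :
    Tendsto (fun n : ℕ => ENNReal.ofReal (Real.exp (-(c * n)))) atTop (𝓝 0) := by
  have h1 : Tendsto (fun n : ℕ => c * (n : ℝ)) atTop atTop :=
    tendsto_natCast_atTop_atTop.const_mul_atTop hc
  simpa using ENNReal.tendsto_ofReal (Real.tendsto_exp_neg_atTop_nhds_zero.comp h1)

theorem tendsto_ofReal_exp {c : ℝ} (hc : 0 < c) :
    Tendsto (fun n : ℕ => ENNReal.ofReal (Real.exp (c * n))) atTop (𝓝 ⊤) :=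
  ENNReal.tendsto_ofReal_atTop.comp (Real.tendsto_exp_atTop.comp
    (tendsto_natCast_atTop_atTop.const_mul_atTop hc))

/-! ### The volume of high-dimensional balls -/

theorem tendsto_log_div_natCast : Tendsto (fun n : ℕ => Real.log n / n) atTop (𝓝 0) := by
  have := (Real.tendsto_pow_log_div_mul_add_atTop 1 0 1 one_ne_zero).comp
    tendsto_natCast_atTop_atTop
  simpa [Function.comp_def] using this

theorem tendsto_log_factorial :
    Tendsto (fun n : ℕ => Real.log n.factorial / n - Real.log n) atTop (𝓝 (-1)) := by
  have h1 : Tendsto (fun n : ℕ => Real.log (Stirling.stirlingSeq n)) atTop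
      (𝓝 (Real.log √Real.pi)) :=
    (Real.continuousAt_log (by positivity)).tendsto.comp Stirling.tendsto_stirlingSeq_sqrt_pi
  have h2 : Tendsto (fun n : ℕ => (Real.log (Stirling.stirlingSeq n) + 1 / 2 * Real.log 2) / n +
      1 / 2 * (Real.log n / n) - 1) atTop (𝓝 (0 + 1 / 2 * 0 - 1)) :=
    (((h1.add_const _).div_atTop tendsto_natCast_atTop_atTop).add
      (tendsto_log_div_natCast.const_mul _)).sub_const 1
  norm_num at h2
  refine h2.congr' ?_
  filter_upwards [eventually_ne_atTop 0] with n hn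
  have h0 : (n : ℝ) ≠ 0 := by exact_mod_cast hn
  rw [Stirling.log_stirlingSeq_formula, Real.log_mul two_ne_zero h0,
    Real.log_div h0 (Real.exp_ne_zero 1), Real.log_exp]
  field_simp
  ring

/-- Legendre's duplication formula at `(n + 1) / 2`. It reduces half-integer Gamma values to
factorials without a case split on the parity of `n`. -/
theorem Gamma_mul_Gamma_succ_half (n : ℕ) :
    Real.Gamma ((n + 1) / 2) * Real.Gamma (n / 2 + 1) = n.factorial * 2 ^ (-(n : ℝ)) * √Real.pi := by
  have h := Real.Gamma_mul_Gamma_add_half ((n + 1) / 2)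
  rw [show ((n : ℝ) + 1) / 2 + 1 / 2 = n / 2 + 1 by ring,
    show 2 * (((n : ℝ) + 1) / 2) = n + 1 by ring, Real.Gamma_nat_eq_factorial] at h
  rw [h]
  ring_nf

/-- The two Gamma factors in the duplication formula differ by a factor between `1` and `n`, so each
is the square root of the product up to a polynomial factor. The bound `4 ≤ n` puts `n / 2` in `[2,
∞)`, where Gamma is monotone. -/
theorem log_Gamma_half_bounds {n : ℕ} (hn : 4 ≤ n) :
    Real.log n.factorial - n * Real.log 2 + Real.log √Real.pi ≤ 2 * Real.log (Real.Gamma (n / 2 + 1))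
    ∧ 2 * Real.log (Real.Gamma (n / 2 + 1)) ≤
      Real.log n.factorial - n * Real.log 2 + Real.log √Real.pi + Real.log n := by
  have hn' : (4 : ℝ) ≤ n := by exact_mod_cast hn
  have hmono := Real.Gamma_strictMonoOn_Ici.monotoneOn
  have hG : 0 < Real.Gamma (n / 2 + 1) := Real.Gamma_pos_of_pos (by positivity)
  have hH : 0 < Real.Gamma ((n + 1) / 2) := Real.Gamma_pos_of_pos (by positivity)
  have h1 : Real.Gamma ((n + 1) / 2) ≤ Real.Gamma (n / 2 + 1) :=
    hmono (by simp; linarith) (by simp; linarith) (by linarith)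
  have h2 : Real.Gamma (n / 2 + 1) ≤ n * Real.Gamma ((n + 1) / 2) := by
    rw [Real.Gamma_add_one (by positivity)]
    have h3 : Real.Gamma (n / 2) ≤ Real.Gamma ((n + 1) / 2) :=
      hmono (by simp; linarith) (by simp; linarith) (by linarith)
    have h4 : 0 < Real.Gamma (n / 2 : ℝ) := Real.Gamma_pos_of_pos (by positivity)
    exact mul_le_mul (by linarith) h3 h4.le (by positivity)
  have hlog := congrArg Real.log (Gamma_mul_Gamma_succ_half n)
  rw [Real.log_mul hH.ne' hG.ne', Real.log_mul (by positivity) (by positivity),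
    Real.log_mul (by positivity) (by positivity), Real.log_rpow two_pos] at hlog
  have h1' := Real.log_le_log hH h1
  have h2' := Real.log_le_log hG h2
  rw [Real.log_mul (by positivity) hH.ne'] at h2'
  constructor <;> linarith

theorem tendsto_log_Gamma_half :
    Tendsto (fun n : ℕ => Real.log (Real.Gamma (n / 2 + 1)) / n - 1 / 2 * Real.log n) atTop
      (𝓝 (-(1 / 2) - 1 / 2 * Real.log 2)) := by
  have hc : Tendsto (fun n : ℕ => Real.log √Real.pi / n) atTop (𝓝 0) :=
    tendsto_const_nhds.div_atTop tendsto_natCast_atTop_atTop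
  have hlow := ((tendsto_log_factorial.sub_const (Real.log 2)).add hc).const_mul (1 / 2)
  have hupp := hlow.add (tendsto_log_div_natCast.const_mul (1 / 2))
  rw [show 1 / 2 * (-1 - Real.log 2 + 0) = -(1 / 2) - 1 / 2 * Real.log 2 by ring] at hlow hupp
  rw [mul_zero, add_zero] at hupp
  refine tendsto_of_tendsto_of_tendsto_of_le_of_le' hlow hupp ?_ ?_
  all_goals
    filter_upwards [eventually_ge_atTop 4] with n hn
    have h0 : (0 : ℝ) < n := by exact_mod_cast (by omega : 0 < n)
    obtain ⟨h1, h2⟩ := log_Gamma_half_bounds hn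
    generalize Real.log (Real.Gamma (n / 2 + 1)) = G at h1 h2
    rw [← mul_le_mul_iff_right₀ h0]
    field_simp
    linarith

/-- The volume of the ball of radius `√n` in dimension `n`. -/
noncomputable def sqrtBallVolume (n : ℕ) : ℝ≥0∞ :=
  ENNReal.ofReal (√(n : ℝ) ^ n * (√Real.pi ^ n / Real.Gamma (n / 2 + 1)))

theorem volume_ball_mul_sqrt {n : ℕ} (hn : n ≠ 0) (x y : ℝ≥0) :
    volume (Metric.ball (0 : Space n) (((y : ℝ) + x) * √(n : ℝ))) =
      sqrtBallVolume n * ((x : ℝ≥0∞) + y) ^ n := by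
  have : Nonempty (Fin n) := ⟨⟨0, Nat.pos_of_ne_zero hn⟩⟩
  have hxy : (x : ℝ≥0∞) + y = ENNReal.ofReal ((y : ℝ) + x) := by
    rw [ENNReal.ofReal_add (by positivity) (by positivity), ENNReal.ofReal_coe_nnreal,
      ENNReal.ofReal_coe_nnreal, add_comm]
  rw [EuclideanSpace.volume_ball, Fintype.card_fin, sqrtBallVolume, hxy,
    ← ENNReal.ofReal_pow (by positivity), ← ENNReal.ofReal_pow (by positivity),
    ← ENNReal.ofReal_mul (by positivity), ← ENNReal.ofReal_mul (by positivity)]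
  congr 1
  rw [mul_pow]
  ring

theorem hasExpRate_sqrtBallVolume :
    HasExpRate sqrtBallVolume (1 / 2 * Real.log (2 * Real.pi * Real.exp 1)) := by
  have h1 : Tendsto (fun n : ℕ => 1 / 2 * Real.log Real.pi -
      (Real.log (Real.Gamma (n / 2 + 1)) / n - 1 / 2 * Real.log n)) atTop
      (𝓝 (1 / 2 * Real.log (2 * Real.pi * Real.exp 1))) := by
    convert! tendsto_log_Gamma_half.const_sub (1 / 2 * Real.log Real.pi) using 2
    rw [Real.log_mul (by positivity) (by positivity), Real.log_mul (by positivity) (by positivity),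
      Real.log_exp]
    ring
  refine (hasExpRate_exp h1).congr ?_
  filter_upwards [eventually_ne_atTop 0] with n hn
  have h0 : (0 : ℝ) < n := by exact_mod_cast Nat.pos_of_ne_zero hn
  have hG : 0 < Real.Gamma (n / 2 + 1) := Real.Gamma_pos_of_pos (by positivity)
  rw [sqrtBallVolume]
  congr 1
  rw [← Real.exp_log (show 0 < √(n : ℝ) ^ n * (√Real.pi ^ n / Real.Gamma (n / 2 + 1)) by positivity),
    Real.log_mul (by positivity) (by positivity), Real.log_div (by positivity) hG.ne',
    Real.log_pow, Real.log_pow, Real.log_sqrt h0.le, Real.log_sqrt Real.pi_pos.le]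
  congr 1
  field_simp
  ring

/-! ### Large deviations on the exponential scale -/

theorem le_ofReal_exp_of_log_div_lt {a : ℝ≥0∞} {n : ℕ} (hn : n ≠ 0) {c : ℝ}
    (h : ENNReal.log a / (n : EReal) < c) : a ≤ ENNReal.ofReal (Real.exp (n * c)) := by
  by_contra! hlt
  refine h.not_ge ?_
  rw [← log_ofReal_exp_div hn c]
  exact EReal.div_le_div_right_of_nonneg (by positivity) (ENNReal.log_monotone hlt.le)

theorem ofReal_exp_le_of_lt_log_div {a : ℝ≥0∞} {n : ℕ} (hn : n ≠ 0) {c : ℝ}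
    (h : c < ENNReal.log a / (n : EReal)) : ENNReal.ofReal (Real.exp (n * c)) ≤ a := by
  by_contra! hlt
  refine h.not_ge ?_
  rw [← log_ofReal_exp_div hn c]
  exact EReal.div_le_div_right_of_nonneg (by positivity) (ENNReal.log_monotone hlt.le)

/-- Exponential bounds, with rate function `I`, for the probabilities of closed and open sets
under measures on `[0, ∞)`. -/
structure HasExpBounds (ν : ℕ → Measure ℝ≥0) (I : ℝ → ℝ≥0∞) : Prop where
  upper : ∀ C : Set ℝ, IsClosed C → ∀ s : ℝ≥0, (∀ x ∈ C, (s : ℝ≥0∞) ≤ I x) → ∀ δ > 0,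
    ∀ᶠ n : ℕ in atTop, ν n ((↑) ⁻¹' C) ≤ ENNReal.ofReal (Real.exp (n * (δ - s)))
  lower : ∀ O : Set ℝ, IsOpen O → ∀ x ∈ O, ∀ s : ℝ≥0, I x ≤ s → ∀ δ > 0,
    ∀ᶠ n : ℕ in atTop, ENNReal.ofReal (Real.exp (n * (-s - δ))) ≤ ν n ((↑) ⁻¹' O)

/-- Trades limits in `EReal` for eventual real inequalities. Since `s` is any finite lower bound of
the rate, a set of infinite rate is handled by taking `s` as large as needed. -/
theorem SatisfiesLDP.hasExpBounds {Ω : Type*} [MeasurableSpace Ω] {P : Measure Ω}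
    {X : ℕ → Ω → ℝ≥0} (hX : ∀ n, 1 ≤ n → AEMeasurable (X n) P) {I : ℝ → ℝ≥0∞}
    (h : SatisfiesLDP (fun n => P.map (fun ω => (X n ω : ℝ))) I) :
    HasExpBounds (fun n => P.map (X n)) I := by
  have hmap {n : ℕ} (hn : n ≠ 0) {s : Set ℝ} (hs : MeasurableSet s) :
      P.map (X n) ((↑) ⁻¹' s) = P.map (fun ω => (X n ω : ℝ)) s := by
    have hXn := hX n (Nat.one_le_iff_ne_zero.2 hn)
    rw [Measure.map_apply_of_aemeasurable hXn (hs.preimage measurable_coe_nnreal_real),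
      Measure.map_apply_of_aemeasurable hXn.coe_nnreal_real hs]
    rfl
  constructor
  · intro C hC s hs δ hδ
    have hlt : limsup (fun n : ℕ => ENNReal.log (P.map (fun ω => (X n ω : ℝ)) C) / (n : EReal))
        atTop < ((δ - s : ℝ) : EReal) := by
      refine (h.upper C hC).trans_lt ?_
      have h1 : (s : ℝ≥0∞) ≤ ⨅ x ∈ C, I x := le_iInf₂ hs
      have h2 : ((s : ℝ) : EReal) ≤ ((⨅ x ∈ C, I x : ℝ≥0∞) : EReal) :=
        EReal.coe_ennreal_le_coe_ennreal_iff.2 h1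
      refine (EReal.neg_le_neg_iff.2 h2).trans_lt ?_
      rw [← EReal.coe_neg, EReal.coe_lt_coe_iff]
      linarith
    filter_upwards [eventually_lt_of_limsup_lt hlt, eventually_ne_atTop 0] with n hn h0
    rw [hmap h0 hC.measurableSet]
    exact le_ofReal_exp_of_log_div_lt h0 hn
  · intro O hO x hx s hs δ hδ
    have hlt : (((-s - δ : ℝ)) : EReal) < liminf (fun n : ℕ =>
        ENNReal.log (P.map (fun ω => (X n ω : ℝ)) O) / (n : EReal)) atTop := by
      refine lt_of_lt_of_le ?_ (h.lower O hO)
      have h1 : ⨅ x ∈ O, I x ≤ s := (iInf₂_le x hx).trans hs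
      have h2 : ((⨅ x ∈ O, I x : ℝ≥0∞) : EReal) ≤ ((s : ℝ) : EReal) :=
        EReal.coe_ennreal_le_coe_ennreal_iff.2 h1
      refine lt_of_lt_of_le ?_ (EReal.neg_le_neg_iff.2 h2)
      rw [← EReal.coe_neg, EReal.coe_lt_coe_iff]
      linarith
    filter_upwards [eventually_lt_of_lt_liminf (β := EReal) hlt, eventually_ne_atTop 0] with n hn h0
    rw [hmap h0 hO.measurableSet]
    exact ofReal_exp_le_of_lt_log_div h0 hn

section Rate

variable {ν : ℕ → Measure ℝ≥0} {I : ℝ → ℝ≥0∞} {γ : ℝ}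

/-- The moment condition makes the tails of the `n`-th moments superexponentially small. -/
theorem exists_tail_le (hγ : 1 < γ) {C : ℝ≥0} (hC : 0 < C)
    (hmom : ∀ᶠ n : ℕ in atTop, ∫⁻ x, (x : ℝ≥0∞) ^ (γ * n) ∂(ν n) ≤ (C : ℝ≥0∞) ^ n) (K : ℝ) :
    ∃ B : ℝ≥0, ∀ᶠ n : ℕ in atTop,
      ∫⁻ x in Ioi B, (x : ℝ≥0∞) ^ n ∂(ν n) ≤ ENNReal.ofReal (Real.exp (n * K)) := by
  -- For `x` beyond `D ^ (γ - 1)⁻¹` one has `D^n x^n ≤ x^(γ n)`, so the tail is at most `(C / D)^n`;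
  -- this `D` makes `C / D = exp K`.
  set D : ℝ≥0 := C * (Real.exp (-K)).toNNReal
  have hD : 0 < D := mul_pos hC (by simpa using Real.exp_pos _)
  refine ⟨D ^ (γ - 1)⁻¹, ?_⟩
  filter_upwards [hmom] with n hn
  have hpt (x : ℝ≥0) (hx : x ∈ Ioi (D ^ (γ - 1)⁻¹)) :
      (D : ℝ≥0∞) ^ n * (x : ℝ≥0∞) ^ n ≤ (x : ℝ≥0∞) ^ (γ * n) := by
    have hx0 : x ≠ 0 := (zero_le.trans_lt hx).ne'
    have h1 : D ≤ x ^ (γ - 1) := by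
      have := NNReal.rpow_le_rpow (le_of_lt hx) (sub_pos.2 hγ).le
      rwa [← NNReal.rpow_mul, inv_mul_cancel₀ (sub_pos.2 hγ).ne', NNReal.rpow_one] at this
    rw [← ENNReal.coe_rpow_of_ne_zero hx0]
    norm_cast
    calc D ^ n * x ^ n ≤ (x ^ (γ - 1)) ^ n * x ^ n := by gcongr
      _ = (x ^ γ) ^ n := by
        rw [← mul_pow, NNReal.rpow_sub_one hx0, div_mul_cancel₀ _ hx0]
      _ = x ^ (γ * n) := by rw [NNReal.rpow_mul, NNReal.rpow_natCast]
  have hDn0 : (D : ℝ≥0∞) ^ n ≠ 0 := by positivity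
  have hDn : (D : ℝ≥0∞) ^ n ≠ ⊤ := by simp
  have h2 : (D : ℝ≥0∞) ^ n * ∫⁻ x in Ioi (D ^ (γ - 1)⁻¹), (x : ℝ≥0∞) ^ n ∂(ν n) ≤
      (C : ℝ≥0∞) ^ n := by
    rw [← lintegral_const_mul _ (by fun_prop)]
    refine (setLIntegral_mono' measurableSet_Ioi hpt).trans ?_
    exact (setLIntegral_le_lintegral _ _).trans hn
  have h3 : (C : ℝ≥0∞) ^ n = (D : ℝ≥0∞) ^ n * ENNReal.ofReal (Real.exp (n * K)) := by
    have : (C : ℝ≥0∞) = D * ENNReal.ofReal (Real.exp K) := by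
      have he : (Real.exp (-K)).toNNReal * (Real.exp K).toNNReal = 1 := by
        rw [← Real.toNNReal_mul (Real.exp_nonneg _), ← Real.exp_add]; simp
      rw [ENNReal.ofReal, ← ENNReal.coe_mul, mul_assoc, he, mul_one]
    rw [Real.exp_nat_mul, ENNReal.ofReal_pow (Real.exp_nonneg _), ← mul_pow, ← this]
  rw [h3] at h2
  exact (ENNReal.mul_le_mul_iff_right hDn0 hDn).1 h2

theorem tendsto_exp_mul_of_neg {c : ℝ} (hc : c < 0) :
    Tendsto (fun n : ℕ => ENNReal.ofReal (Real.exp (n * c))) atTop (𝓝 0) := by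
  refine (tendsto_ofReal_exp_neg (neg_pos.2 hc)).congr fun n => ?_
  congr 2; ring

theorem HasExpBounds.tendsto_zero (h : HasExpBounds ν I) {C : Set ℝ} (hC : IsClosed C) {c : ℝ≥0}
    (hc : 0 < c) (hI : ∀ x ∈ C, (c : ℝ≥0∞) ≤ I x) :
    Tendsto (fun n => ν n ((↑) ⁻¹' C)) atTop (𝓝 0) := by
  have hc' : (0 : ℝ) < c := hc
  refine tendsto_of_tendsto_of_tendsto_of_le_of_le' tendsto_const_nhds
    (tendsto_exp_mul_of_neg (c := (c : ℝ) / 2 - c) (by linarith))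
    (Eventually.of_forall fun n => zero_le) ?_
  exact h.upper C hC c hI _ (half_pos hc')

/-- Otherwise the whole line would have exponentially small mass, against total mass `1`. -/
theorem HasExpBounds.exists_le (h : HasExpBounds ν I)
    (hν : ∀ n, n ≠ 0 → IsProbabilityMeasure (ν n)) {c : ℝ≥0} (hc : 0 < c) : ∃ x, I x ≤ c := by
  by_contra! hI
  have h1 := h.tendsto_zero isClosed_univ hc fun x _ => (hI x).le
  have h2 : Tendsto (fun n => ν n ((↑) ⁻¹' (univ : Set ℝ))) atTop (𝓝 1) := by
    refine tendsto_const_nhds.congr' ?_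
    filter_upwards [eventually_ne_atTop 0] with n hn
    have := hν n hn
    simp
  exact zero_ne_one (tendsto_nhds_unique h1 h2)

/-- The mean is not on the left of a set carrying almost all the mass. -/
theorem HasExpBounds.le_of_tendsto_mean (h : HasExpBounds ν I)
    (hν : ∀ n, n ≠ 0 → IsProbabilityMeasure (ν n)) {R : ℝ≥0}
    (hmean : Tendsto (fun n => ∫⁻ x, (x : ℝ≥0∞) ∂(ν n)) atTop (𝓝 (R : ℝ≥0∞)))
    {t c : ℝ≥0} (hc : 0 < c) (hI : ∀ x ∈ Iic (t : ℝ), (c : ℝ≥0∞) ≤ I x) : t ≤ R := by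
  have h1 := h.tendsto_zero isClosed_Iic hc hI
  have hpre : ((↑) : ℝ≥0 → ℝ) ⁻¹' Iic (t : ℝ) = Iic t := by ext; simp
  rw [hpre] at h1
  have h2 : Tendsto (fun n => (t : ℝ≥0∞) * (1 - ν n (Iic t))) atTop (𝓝 t) := by
    have := ENNReal.Tendsto.const_mul (a := (t : ℝ≥0∞))
      (ENNReal.Tendsto.sub tendsto_const_nhds h1 (Or.inl ENNReal.one_ne_top))
      (Or.inr ENNReal.coe_ne_top)
    simpa using this
  refine ENNReal.coe_le_coe.1 (le_of_tendsto_of_tendsto h2 hmean ?_)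
  filter_upwards [eventually_ne_atTop 0] with n hn
  have := hν n hn
  rw [← prob_compl_eq_one_sub measurableSet_Iic, compl_Iic, ← setLIntegral_const]
  refine (setLIntegral_mono' measurableSet_Ioi fun x hx => ?_).trans
    (setLIntegral_le_lintegral _ _)
  exact ENNReal.coe_le_coe.2 (le_of_lt hx)

/-- The mean is not on the right of a set carrying almost all the mass. -/
theorem HasExpBounds.ge_of_tendsto_mean (h : HasExpBounds ν I)
    (hν : ∀ n, n ≠ 0 → IsProbabilityMeasure (ν n)) {R : ℝ≥0}
    (hmean : Tendsto (fun n => ∫⁻ x, (x : ℝ≥0∞) ∂(ν n)) atTop (𝓝 (R : ℝ≥0∞)))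
    (hγ : 1 < γ) {C : ℝ≥0} (hC : 0 < C)
    (hmom : ∀ᶠ n : ℕ in atTop, ∫⁻ x, (x : ℝ≥0∞) ^ (γ * n) ∂(ν n) ≤ (C : ℝ≥0∞) ^ n)
    {t c : ℝ≥0} (hc : 0 < c) (hI : ∀ x ∈ Ici (t : ℝ), (c : ℝ≥0∞) ≤ I x) : R ≤ t := by
  have h1 := h.tendsto_zero isClosed_Ici hc hI
  have hpre : ((↑) : ℝ≥0 → ℝ) ⁻¹' Ici (t : ℝ) = Ici t := by ext; simp
  rw [hpre] at h1
  -- Uniform integrability: the part of the mean above `max B 1` is at most the tail of the `n`-th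
  -- moment, since `x ≤ x^n` for `x ≥ 1`. Any negative exponent would do.
  obtain ⟨B, hB⟩ := exists_tail_le hγ hC hmom (-1)
  have h2 : Tendsto (fun n : ℕ => (t : ℝ≥0∞) + (((max B 1 : ℝ≥0) : ℝ≥0∞) * ν n (Ici t) +
      ENNReal.ofReal (Real.exp (n * (-1))))) atTop (𝓝 t) := by
    have := (ENNReal.Tendsto.const_mul (a := ((max B 1 : ℝ≥0) : ℝ≥0∞)) h1
      (Or.inr ENNReal.coe_ne_top)).add (tendsto_exp_mul_of_neg (c := -1) (by norm_num))
    simpa using this.const_add (t : ℝ≥0∞)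
  refine ENNReal.coe_le_coe.1 (le_of_tendsto_of_tendsto hmean h2 ?_)
  filter_upwards [eventually_ne_atTop 0, hB] with n hn hBn
  have := hν n hn
  calc ∫⁻ x, (x : ℝ≥0∞) ∂(ν n)
      ≤ ∫⁻ x, ((t : ℝ≥0∞) + ((Ici t).indicator (fun _ => ((max B 1 : ℝ≥0) : ℝ≥0∞)) x +
          (Ioi B).indicator (fun x => (x : ℝ≥0∞) ^ n) x)) ∂(ν n) := by
        refine lintegral_mono fun x => ?_
        rcases lt_or_ge x t with hx | hx
        · exact le_add_right (ENNReal.coe_le_coe.2 hx.le)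
        · refine le_add_left ?_
          rcases le_or_gt x (max B 1) with hxB | hxB
          · refine le_add_right ?_
            rw [indicator_of_mem (by exact hx)]
            exact ENNReal.coe_le_coe.2 hxB
          · refine le_add_left ?_
            rw [indicator_of_mem (by exact (le_max_left _ _).trans_lt hxB)]
            have h1x : (1 : ℝ≥0) ≤ x := (le_max_right _ _).trans hxB.le
            exact le_self_pow (ENNReal.one_le_coe_iff.2 h1x) hn
    _ = _ := by
        rw [lintegral_add_left measurable_const, lintegral_add_left
          (measurable_const.indicator measurableSet_Ici), lintegral_indicator measurableSet_Ici,
          lintegral_indicator measurableSet_Ioi, lintegral_const, setLIntegral_const,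
          measure_univ, mul_one]
    _ ≤ _ := by gcongr

/-- The rate function vanishes at the limit of the means. -/
theorem HasExpBounds.rate_eq_zero (h : HasExpBounds ν I)
    (hν : ∀ n, n ≠ 0 → IsProbabilityMeasure (ν n)) (hgood : IsGoodRate I)
    (hconv : ConvexOn ℝ≥0 univ I) {R : ℝ≥0} (hR : 0 < R)
    (hmean : Tendsto (fun n => ∫⁻ x, (x : ℝ≥0∞) ∂(ν n)) atTop (𝓝 (R : ℝ≥0∞)))
    (hγ : 1 < γ) {C : ℝ≥0} (hC : 0 < C)
    (hmom : ∀ᶠ n : ℕ in atTop, ∫⁻ x, (x : ℝ≥0∞) ^ (γ * n) ∂(ν n) ≤ (C : ℝ≥0∞) ^ n) :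
    I R = 0 := by
  by_contra hne
  obtain ⟨c, hc0, hcR⟩ := ENNReal.lt_iff_exists_nnreal_btwn.1 (pos_iff_ne_zero.2 hne)
  have hc : 0 < c := by exact_mod_cast hc0
  set K : Set ℝ := {x | I x ≤ c}
  -- The sublevel set is a closed interval avoiding `R`, so it lies entirely on one side, at
  -- distance at least `η`. The mass concentrates near it, and the mean would have to follow.
  have hKconv : OrdConnected K := by
    have h1 := hconv.convex_le (c : ℝ≥0∞)
    have h2 : Convex ℝ K := by
      intro x hx y hy a b ha hb hab
      have := h1 ⟨mem_univ x, hx⟩ ⟨mem_univ y, hy⟩ (a := ⟨a, ha⟩) (b := ⟨b, hb⟩) zero_le zero_le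
        (NNReal.eq hab)
      exact this.2
    exact h2.ordConnected
  have hRK : (R : ℝ) ∈ Kᶜ := hcR.not_ge
  have hopen : IsOpen Kᶜ := (hgood.compact_sublevel c).isClosed.isOpen_compl
  obtain ⟨η, hη, hball⟩ := Metric.isOpen_iff.1 hopen R hRK
  have hnear (y : ℝ) (hy : y ∈ K) : η ≤ |y - R| := by
    by_contra! hlt
    exact hball (by simpa [Real.dist_eq] using hlt) hy
  obtain ⟨x, hx⟩ := h.exists_le hν hc
  rcases lt_or_ge x R with hxR | hxR
  · have hK (y : ℝ) (hy : y ∈ K) : y ≤ R - η := by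
      have hyR : y < R := by
        by_contra! hRy
        exact hRK (hKconv.out hx hy ⟨hxR.le, hRy⟩)
      have := hnear y hy
      rw [abs_of_neg (sub_neg.2 hyR)] at this
      linarith
    -- If `R - η / 2` is negative the truncation gives `0`, and the resulting `R ≤ 0` is still
    -- absurd.
    have := h.ge_of_tendsto_mean hν hmean hγ hC hmom (t := (R - η / 2 : ℝ).toNNReal) hc
      fun y hy => by
        by_contra! hlt
        have h1 := hK y hlt.le
        have h2 := (Real.le_coe_toNNReal _).trans (mem_Ici.1 hy)
        linarith
    have h3 : (R : ℝ) ≤ max (R - η / 2) 0 := this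
    have h4 : (0 : ℝ) < R := hR
    rcases le_max_iff.1 h3 with h5 | h5 <;> linarith
  · have hK (y : ℝ) (hy : y ∈ K) : R + η ≤ y := by
      have hyR : R < y := by
        by_contra! hRy
        exact hRK (hKconv.out hy hx ⟨hRy, hxR⟩)
      have := hnear y hy
      rw [abs_of_pos (sub_pos.2 hyR)] at this
      linarith
    have := h.le_of_tendsto_mean hν hmean (t := R + (η / 2).toNNReal) hc
      fun y hy => by
        by_contra! hlt
        have h1 := hK y hlt.le
        have h2 := mem_Iic.1 hy
        rw [NNReal.coe_add, Real.coe_toNNReal _ (by positivity)] at h2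
        linarith
    have h3 : (R : ℝ) + (η / 2).toNNReal ≤ R := this
    rw [Real.coe_toNNReal _ (by positivity)] at h3
    linarith

end Rate

/-! ### Asymptotics of the moments of the sum of two independent marks -/

section Laplace

variable {ν : ℕ → Measure ℝ≥0} {I : ℝ → ℝ≥0∞} {γ : ℝ} {R : ℝ≥0} {τ : ℝ}

theorem ofReal_pow_eq_exp {t : ℝ} (ht : 0 < t) (n : ℕ) :
    ENNReal.ofReal t ^ n = ENNReal.ofReal (Real.exp (n * Real.log t)) := by
  rw [← ENNReal.ofReal_pow ht.le, Real.exp_nat_mul, Real.exp_log ht]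

theorem pow_mul_measure_Ioi_le (μ : Measure ℝ≥0) (t : ℝ≥0) (n : ℕ) :
    (t : ℝ≥0∞) ^ n * μ (Ioi t) ≤ ∫⁻ x in Ioi t, (x : ℝ≥0∞) ^ n ∂μ := by
  rw [← setLIntegral_const]
  refine setLIntegral_mono' measurableSet_Ioi fun x hx => ?_
  gcongr
  exact le_of_lt hx

theorem preimage_coe_Ioi (t : ℝ≥0) : ((↑) : ℝ≥0 → ℝ) ⁻¹' Ioi (t : ℝ) = Ioi t := by
  ext; simp

/-- The moment condition forces the rate function to grow at least logarithmically. -/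
theorem HasExpBounds.exists_lower_bound (h : HasExpBounds ν I) (hR : 0 < R) (hγ : 1 < γ)
    {C : ℝ≥0} (hC : 0 < C)
    (hmom : ∀ᶠ n : ℕ in atTop, ∫⁻ x, (x : ℝ≥0∞) ^ (γ * n) ∂(ν n) ≤ (C : ℝ≥0∞) ^ n) :
    ∃ b : ℝ, ∀ r : ℝ, R ≤ r → ∀ s : ℝ≥0, I r ≤ s → b ≤ 2 * s - Real.log (2 * r) := by
  obtain ⟨B, hB⟩ := exists_tail_le hγ hC hmom 0
  have hR' : (0 : ℝ) < R := hR
  refine ⟨-Real.log (4 * max (B : ℝ) 1), fun r hr s hs => ?_⟩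
  have hr0 : 0 < r := hR'.trans_le hr
  have hM : (1 : ℝ) ≤ max (B : ℝ) 1 := le_max_right _ _
  rcases lt_or_ge r (2 * max (B : ℝ) 1) with hlt | hge
  · have h1 : Real.log (2 * r) ≤ Real.log (4 * max (B : ℝ) 1) :=
      Real.log_le_log (by positivity) (by linarith)
    have h2 := s.coe_nonneg
    linarith
  -- Marks near `r` exceed `r / 2 ≥ B`, so the tail of the `n`-th moment is at least about `(r /
  -- 2)^n exp (-n s)`, yet it is at most `1`.
  · have hs' : Real.log (r / 2) ≤ s := by
      by_contra! hlt
      set δ := (Real.log (r / 2) - s) / 2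
      have hδ : 0 < δ := by simp only [δ]; linarith
      set t : ℝ≥0 := (r / 2).toNNReal
      have ht : (t : ℝ) = r / 2 := Real.coe_toNNReal _ (by positivity)
      have hBt : B ≤ t := by
        have : (B : ℝ) ≤ t := by rw [ht]; linarith [le_max_left (B : ℝ) 1]
        exact this
      obtain ⟨n, ⟨h1, h2⟩, hn⟩ := ((hB.and (h.lower (Ioi (t : ℝ)) isOpen_Ioi r
        (by rw [mem_Ioi, ht]; linarith) s hs δ hδ)).and (eventually_gt_atTop 0)).exists
      rw [preimage_coe_Ioi] at h2
      have h3 : (t : ℝ≥0∞) ^ n * ENNReal.ofReal (Real.exp (n * (-s - δ))) ≤ 1 :=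
        calc _ ≤ (t : ℝ≥0∞) ^ n * ν n (Ioi t) := by gcongr
          _ ≤ ∫⁻ x in Ioi t, (x : ℝ≥0∞) ^ n ∂(ν n) := pow_mul_measure_Ioi_le _ _ _
          _ ≤ ∫⁻ x in Ioi B, (x : ℝ≥0∞) ^ n ∂(ν n) :=
            lintegral_mono_set (Ioi_subset_Ioi hBt)
          _ ≤ 1 := by simpa using h1
      rw [← ENNReal.ofReal_coe_nnreal (p := t), ht, ofReal_pow_eq_exp (by positivity),
        ← ENNReal.ofReal_mul (Real.exp_nonneg _), ← Real.exp_add,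
        ENNReal.ofReal_le_one, Real.exp_le_one_iff] at h3
      have h4 : (0 : ℝ) < n := by exact_mod_cast hn
      have h5 : n * Real.log (r / 2) + n * (-s - δ) = n * δ := by simp only [δ]; ring
      rw [h5] at h3
      exact absurd h3 (not_le.2 (mul_pos h4 hδ))
    have h1 : 2 * Real.log (r / 2) - Real.log (2 * r) + Real.log (4 * max (B : ℝ) 1) ≥ 0 := by
      rw [Real.log_div (by positivity) (by positivity), Real.log_mul (by positivity) (by positivity),
        Real.log_mul (by positivity) (by positivity), show (4 : ℝ) = 2 ^ 2 by norm_num, Real.log_pow]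
      have h2 : Real.log 2 ≤ Real.log r := Real.log_le_log (by norm_num) (by linarith)
      have h3 : 0 ≤ Real.log (max (B : ℝ) 1) := Real.log_nonneg hM
      push_cast
      linarith
    linarith

/-- The closed cell `[i η, (i + 1) η]`. -/
def cell (η : ℝ) (i : ℕ) : Set ℝ := Icc (i * η) ((i + 1) * η)

theorem exists_near_inf {S : Set ℝ} (hS : ∃ x ∈ S, I x < ⊤) :
    ∃ s : ℝ≥0, (∀ x ∈ S, (s : ℝ≥0∞) ≤ I x) ∧ ∀ δ : ℝ≥0, 0 < δ → ∃ x ∈ S, I x ≤ (s + δ : ℝ≥0) := by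
  obtain ⟨x, hx, hxt⟩ := hS
  have hfin : ⨅ x ∈ S, I x ≠ ⊤ := ((iInf₂_le x hx).trans_lt hxt).ne
  have hcoe := ENNReal.coe_toNNReal hfin
  refine ⟨(⨅ x ∈ S, I x).toNNReal, fun y hy => hcoe.trans_le (iInf₂_le y hy), fun δ hδ => ?_⟩
  have hlt : ⨅ x ∈ S, I x < (((⨅ x ∈ S, I x).toNNReal + δ : ℝ≥0) : ℝ≥0∞) := by
    rw [ENNReal.coe_add, hcoe]
    exact ENNReal.lt_add_right hfin (by simpa using hδ.ne')
  simp only [iInf_lt_iff, exists_prop] at hlt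
  obtain ⟨y, hy, hlt'⟩ := hlt
  exact ⟨y, hy, hlt'.le⟩

/-- The only use of convexity in the moment asymptotics: replacing two marks by their average keeps
the sum and does not raise the total rate. -/
theorem rate_half_add_half_le (hconv : ConvexOn ℝ≥0 univ I) {x y : ℝ} {s t : ℝ≥0} (hx : I x ≤ s)
    (hy : I y ≤ t) : I ((x + y) / 2) ≤ ((s + t) / 2 : ℝ≥0) := by
  have hsum : (1 / 2 : ℝ≥0) + 1 / 2 = 1 := by
    rw [← add_div, one_add_one_eq_two, div_self two_ne_zero]
  have h := hconv.2 (mem_univ x) (mem_univ y) zero_le zero_le hsum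
  have hxy : (1 / 2 : ℝ≥0) • x + (1 / 2 : ℝ≥0) • y = (x + y) / 2 := by
    simp only [NNReal.smul_def, smul_eq_mul]
    push_cast
    ring
  rw [hxy] at h
  refine h.trans ?_
  have h1 : (((s + t) / 2 : ℝ≥0) : ℝ≥0∞) = (1 / 2 : ℝ≥0) • (s : ℝ≥0∞) + (1 / 2 : ℝ≥0) • (t : ℝ≥0∞) := by
    simp only [ENNReal.smul_def, smul_eq_mul]
    norm_cast
    ring
  rw [h1]
  gcongr

/-- The contribution of one pair of cells, with `W` the largest sum of marks it allows. The error `η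
/ R` is the cost of rounding up to the cell edges. -/
theorem HasExpBounds.eventually_cells_le (h : HasExpBounds ν I)
    (hν : ∀ n, n ≠ 0 → IsProbabilityMeasure (ν n)) (hconv : ConvexOn ℝ≥0 univ I)
    (hR : 0 < R) (hIR : I R = 0)
    (hτ : ∀ r : ℝ, R ≤ r → ∀ s : ℝ≥0, I r ≤ s → τ ≤ 2 * s - Real.log (2 * r))
    {η : ℝ} (hη : 0 < η) {ε : ℝ} (hε : 0 < ε) (i j : ℕ) :
    ∀ᶠ n : ℕ in atTop, ENNReal.ofReal ((i + j + 2) * η) ^ n *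
      (ν n ((↑) ⁻¹' cell η i) * ν n ((↑) ⁻¹' cell η j)) ≤
        ENNReal.ofReal (Real.exp (n * (-τ + η / R + ε))) := by
  have hR' : (0 : ℝ) < R := hR
  set W : ℝ := (i + j + 2) * η
  have hW : 0 < W := by positivity
  have hcl (k : ℕ) : IsClosed (cell η k) := isClosed_Icc
  have key (a b : ℝ) (hab : Real.log W + a + b ≤ -τ + η / R + ε) (i' j' : ℕ)
      (ha : ∀ᶠ n : ℕ in atTop, ν n ((↑) ⁻¹' cell η i') ≤ ENNReal.ofReal (Real.exp (n * a)))
      (hb : ∀ᶠ n : ℕ in atTop, ν n ((↑) ⁻¹' cell η j') ≤ ENNReal.ofReal (Real.exp (n * b))) :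
      ∀ᶠ n : ℕ in atTop, ENNReal.ofReal W ^ n *
        (ν n ((↑) ⁻¹' cell η i') * ν n ((↑) ⁻¹' cell η j')) ≤
        ENNReal.ofReal (Real.exp (n * (-τ + η / R + ε))) := by
    filter_upwards [ha, hb] with n han hbn
    calc _ ≤ ENNReal.ofReal (Real.exp (n * Real.log W)) *
          (ENNReal.ofReal (Real.exp (n * a)) * ENNReal.ofReal (Real.exp (n * b))) := by
          rw [ofReal_pow_eq_exp hW]; gcongr
      _ = ENNReal.ofReal (Real.exp (n * (Real.log W + a + b))) := by
          rw [← ENNReal.ofReal_mul (Real.exp_nonneg _), ← ENNReal.ofReal_mul (Real.exp_nonneg _),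
            ← Real.exp_add, ← Real.exp_add]
          congr 2
          ring
      _ ≤ _ := by gcongr
  have hone (k : ℕ) : ∀ᶠ n : ℕ in atTop,
      ν n ((↑) ⁻¹' cell η k) ≤ ENNReal.ofReal (Real.exp (n * 0)) := by
    filter_upwards [eventually_ne_atTop 0] with n hn
    have := hν n hn
    simpa using prob_le_one
  -- With infinite rate on a cell any exponent is available; `-τ - log W` cancels the factor `W^n`,
  -- and the other cell needs only the trivial bound `1`.
  have htop (k : ℕ) (hk : ¬ ∃ x ∈ cell η k, I x < ⊤) : ∀ᶠ n : ℕ in atTop, ν n ((↑) ⁻¹' cell η k) ≤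
      ENNReal.ofReal (Real.exp (n * (-τ - Real.log W))) := by
    have hs := Real.le_coe_toNNReal (1 + τ + Real.log W)
    filter_upwards [h.upper _ (hcl k) (1 + τ + Real.log W).toNNReal
      (fun x hx => by
        have : I x = ⊤ := by by_contra hne; exact hk ⟨x, hx, lt_top_iff_ne_top.2 hne⟩
        rw [this]; exact le_top) 1 one_pos] with n hn
    exact hn.trans (ENNReal.ofReal_le_ofReal (Real.exp_le_exp.2
      (mul_le_mul_of_nonneg_left (by linarith) (by positivity))))
  have hpos : 0 < η / R := by positivity
  by_cases hi : ∃ x ∈ cell η i, I x < ⊤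
  swap
  · exact key _ _ (by linarith) i j (htop i hi) (hone j)
  by_cases hj : ∃ x ∈ cell η j, I x < ⊤
  swap
  · exact key 0 _ (by linarith) i j (hone i) (htop j hj)
  obtain ⟨s, hs, hs'⟩ := exists_near_inf hi
  obtain ⟨t, ht, ht'⟩ := exists_near_inf hj
  set δ : ℝ≥0 := (ε / 4).toNNReal
  have hδ : (δ : ℝ) = ε / 4 := Real.coe_toNNReal _ (by positivity)
  have hδ0 : 0 < δ := by simpa [δ] using hε
  obtain ⟨x, hx, hIx⟩ := hs' δ hδ0
  obtain ⟨y, hy, hIy⟩ := ht' δ hδ0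
  -- Here `r` is the larger of the average and `R`; moving up to `R` is free because the rate
  -- vanishes there.
  obtain ⟨r, hrR, hxy, hIr⟩ : ∃ r : ℝ, R ≤ r ∧ x + y ≤ 2 * r ∧
      I r ≤ ((s + δ + (t + δ)) / 2 : ℝ≥0) := by
    rcases le_total (R : ℝ) ((x + y) / 2) with hle | hle
    · exact ⟨_, hle, by linarith, rate_half_add_half_le hconv hIx hIy⟩
    · exact ⟨R, le_rfl, by linarith, by rw [hIR]; exact zero_le⟩
  have hr0 : 0 < r := hR'.trans_le hrR
  have h1 := hτ r hrR _ hIr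
  push_cast at h1
  have hlogW : Real.log W ≤ Real.log (2 * r) + η / R := by
    rw [Real.log_le_iff_le_exp hW, Real.exp_add, Real.exp_log (by positivity)]
    have h2 : W ≤ 2 * r + 2 * η := by
      have hx1 := hx.2
      have hy1 := hy.2
      have hx0 : (i : ℝ) * η ≤ x := hx.1
      have hy0 : (j : ℝ) * η ≤ y := hy.1
      simp only [W]
      linarith
    have h3 : 2 * r + 2 * η ≤ 2 * r * (η / R + 1) := by
      have : η ≤ r * (η / R) := by
        rw [mul_div_assoc', le_div_iff₀ hR', mul_comm η]
        gcongr
      linarith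
    refine (h2.trans h3).trans ?_
    gcongr
    exact Real.add_one_le_exp _
  refine key _ _ ?_ i j (h.upper _ (hcl i) s hs (ε / 4) (by positivity))
    (h.upper _ (hcl j) t ht (ε / 4) (by positivity))
  rw [hδ] at h1
  linarith

/-- Keep only the event that both marks exceed a level just below a near-minimizer `r`. The loss `ε`
is four quarters: one for near-optimality, one for lowering `r`, and one for the probability of each
mark. -/
theorem HasExpBounds.eventually_ge (h : HasExpBounds ν I)
    (hν : ∀ n, n ≠ 0 → IsProbabilityMeasure (ν n)) (hR : 0 < R)
    (hτ : ∀ ε > 0, ∃ r : ℝ, R ≤ r ∧ ∃ s : ℝ≥0, I r ≤ s ∧ 2 * s - Real.log (2 * r) < τ + ε)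
    {ε : ℝ} (hε : 0 < ε) : ∀ᶠ n : ℕ in atTop, ENNReal.ofReal (Real.exp (n * (-τ - ε))) ≤
      ∫⁻ z, ((z.1 : ℝ≥0∞) + z.2) ^ n ∂((ν n).prod (ν n)) := by
  obtain ⟨r, hrR, s, hs, hrs⟩ := hτ (ε / 4) (by positivity)
  have hr0 : 0 < r := (show (0 : ℝ) < R from hR).trans_le hrR
  set t : ℝ≥0 := (r * Real.exp (-(ε / 4))).toNNReal
  have ht : (t : ℝ) = r * Real.exp (-(ε / 4)) := Real.coe_toNNReal _ (by positivity)
  have ht0 : 0 < (t : ℝ) := by rw [ht]; positivity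
  have htr : (t : ℝ) < r := by
    rw [ht]
    exact mul_lt_of_lt_one_right hr0 (Real.exp_lt_one_iff.2 (by linarith))
  have hlog : Real.log (2 * t) = Real.log (2 * r) - ε / 4 := by
    rw [ht, ← mul_assoc, Real.log_mul (by positivity) (Real.exp_ne_zero _), Real.log_exp]
    ring
  filter_upwards [h.lower (Ioi (t : ℝ)) isOpen_Ioi r htr s hs (ε / 4) (by positivity),
    eventually_ne_atTop 0] with n hn h0
  have := hν n h0
  rw [preimage_coe_Ioi] at hn
  calc ENNReal.ofReal (Real.exp (n * (-τ - ε)))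
      ≤ ENNReal.ofReal (Real.exp (n * Real.log (2 * t) +
          (n * (-s - ε / 4) + n * (-s - ε / 4)))) := by
        gcongr
        rw [← mul_add, ← mul_add, hlog]
        gcongr
        linarith
    _ = ENNReal.ofReal (2 * t) ^ n * (ENNReal.ofReal (Real.exp (n * (-s - ε / 4))) *
          ENNReal.ofReal (Real.exp (n * (-s - ε / 4)))) := by
        rw [Real.exp_add, Real.exp_add, ENNReal.ofReal_mul (Real.exp_nonneg _),
          ENNReal.ofReal_mul (Real.exp_nonneg _), ofReal_pow_eq_exp (by positivity)]
    _ ≤ ENNReal.ofReal (2 * t) ^ n * (ν n (Ioi t) * ν n (Ioi t)) := by gcongr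
    _ = ∫⁻ _ in Ioi t ×ˢ Ioi t, ENNReal.ofReal (2 * t) ^ n ∂((ν n).prod (ν n)) := by
        rw [setLIntegral_const, Measure.prod_prod]
    _ ≤ ∫⁻ z in Ioi t ×ˢ Ioi t, ((z.1 : ℝ≥0∞) + z.2) ^ n ∂((ν n).prod (ν n)) := by
        refine setLIntegral_mono' (measurableSet_Ioi.prod measurableSet_Ioi) fun z hz => ?_
        gcongr
        rw [two_mul, ENNReal.ofReal_add ht0.le ht0.le, ENNReal.ofReal_coe_nnreal]
        exact add_le_add (ENNReal.coe_le_coe.2 (le_of_lt hz.1))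
          (ENNReal.coe_le_coe.2 (le_of_lt hz.2))
    _ ≤ _ := setLIntegral_le_lintegral _ _

/-- If both marks are at most `B`, they lie in one of the `N * N` pairs of cells. Otherwise the
larger mark exceeds `B` and the sum is at most twice it. -/
theorem add_pow_le_sum_cells {η : ℝ} (hη : 0 < η) {B : ℝ≥0} {N : ℕ} (hN : B / η < N) (n : ℕ)
    (z : ℝ≥0 × ℝ≥0) : ((z.1 : ℝ≥0∞) + z.2) ^ n ≤
      (∑ p ∈ Finset.range N ×ˢ Finset.range N,
        ((((↑) ⁻¹' cell η p.1) ×ˢ ((↑) ⁻¹' cell η p.2) : Set (ℝ≥0 × ℝ≥0)).indicator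
          (fun _ => ENNReal.ofReal ((p.1 + p.2 + 2) * η) ^ n) z)) +
      2 ^ n * ((Ioi B).indicator (fun x : ℝ≥0 => (x : ℝ≥0∞) ^ n) z.1 +
        (Ioi B).indicator (fun x : ℝ≥0 => (x : ℝ≥0∞) ^ n) z.2) := by
  obtain ⟨x, y⟩ := z
  rcases le_or_gt x B with hxB | hxB
  · rcases le_or_gt y B with hyB | hyB
    · refine le_add_right ?_
      have hcell (u : ℝ≥0) (hu : u ≤ B) : ⌊(u : ℝ) / η⌋₊ < N ∧ (u : ℝ) ∈ cell η ⌊(u : ℝ) / η⌋₊ := by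
        have hu' : (u : ℝ) ≤ B := hu
        refine ⟨(Nat.floor_lt (by positivity)).2 (lt_of_le_of_lt (by gcongr) hN), ?_, ?_⟩
        · rw [← le_div_iff₀ hη]; exact Nat.floor_le (by positivity)
        · rw [← div_le_iff₀ hη]; exact (Nat.lt_floor_add_one _).le
      obtain ⟨hx1, hx2⟩ := hcell x hxB
      obtain ⟨hy1, hy2⟩ := hcell y hyB
      refine le_trans ?_ (Finset.single_le_sum (a := (⌊(x : ℝ) / η⌋₊, ⌊(y : ℝ) / η⌋₊))
        (fun _ _ => zero_le) (Finset.mem_product.2 ⟨Finset.mem_range.2 hx1, Finset.mem_range.2 hy1⟩))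
      rw [indicator_of_mem (by exact ⟨hx2, hy2⟩)]
      gcongr
      rw [← ENNReal.ofReal_coe_nnreal, ← ENNReal.ofReal_coe_nnreal,
        ← ENNReal.ofReal_add (by positivity) (by positivity)]
      gcongr
      have hx3 : (x : ℝ) ≤ (⌊(x : ℝ) / η⌋₊ + 1) * η := hx2.2
      have hy3 : (y : ℝ) ≤ (⌊(y : ℝ) / η⌋₊ + 1) * η := hy2.2
      linarith
    · refine le_add_left ?_
      rw [indicator_of_mem (show y ∈ Ioi B from hyB)]
      refine le_trans ?_ (mul_le_mul_right le_add_self _)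
      rw [← mul_pow, two_mul]
      exact pow_le_pow_left' (add_le_add_left (ENNReal.coe_le_coe.2 (hxB.trans hyB.le)) _) n
  · refine le_add_left ?_
    rcases le_total x y with hxy | hxy
    · rw [indicator_of_mem (show y ∈ Ioi B from hxB.trans_le hxy)]
      refine le_trans ?_ (mul_le_mul_right le_add_self _)
      rw [← mul_pow, two_mul]
      exact pow_le_pow_left' (add_le_add_left (ENNReal.coe_le_coe.2 hxy) _) n
    · rw [indicator_of_mem (show x ∈ Ioi B from hxB)]
      refine le_trans ?_ (mul_le_mul_right le_self_add _)
      rw [← mul_pow, two_mul]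
      exact pow_le_pow_left' (add_le_add_right (ENNReal.coe_le_coe.2 hxy) _) n

theorem lintegral_add_pow_le {μ : Measure ℝ≥0} [IsProbabilityMeasure μ] {η : ℝ} (hη : 0 < η)
    {B : ℝ≥0} {N : ℕ} (hN : B / η < N) (n : ℕ) :
    ∫⁻ z, ((z.1 : ℝ≥0∞) + z.2) ^ n ∂(μ.prod μ) ≤
      (∑ p ∈ Finset.range N ×ˢ Finset.range N, ENNReal.ofReal ((p.1 + p.2 + 2) * η) ^ n *
        (μ ((↑) ⁻¹' cell η p.1) * μ ((↑) ⁻¹' cell η p.2))) +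
      2 ^ n * (2 * ∫⁻ x in Ioi B, (x : ℝ≥0∞) ^ n ∂μ) := by
  have hcell (i : ℕ) : MeasurableSet ((↑) ⁻¹' cell η i : Set ℝ≥0) :=
    measurableSet_Icc.preimage measurable_coe_nnreal_real
  have hind : Measurable ((Ioi B).indicator fun x : ℝ≥0 => (x : ℝ≥0∞) ^ n) :=
    (show Measurable fun x : ℝ≥0 => (x : ℝ≥0∞) ^ n by fun_prop).indicator measurableSet_Ioi
  refine (lintegral_mono (add_pow_le_sum_cells hη hN n)).trans_eq ?_
  rw [lintegral_add_right _ (by fun_prop), lintegral_finsetSum _ fun p _ =>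
    measurable_const.indicator ((hcell _).prod (hcell _)), lintegral_const_mul _ (by fun_prop),
    lintegral_add_left (by fun_prop)]
  congr 1
  · refine Finset.sum_congr rfl fun p _ => ?_
    rw [lintegral_indicator_const ((hcell _).prod (hcell _)), Measure.prod_prod]
  · rw [measurePreserving_fst.lintegral_comp hind, measurePreserving_snd.lintegral_comp hind,
      lintegral_indicator measurableSet_Ioi, two_mul]

theorem HasExpBounds.eventually_le (h : HasExpBounds ν I)
    (hν : ∀ n, n ≠ 0 → IsProbabilityMeasure (ν n)) (hconv : ConvexOn ℝ≥0 univ I)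
    (hR : 0 < R) (hIR : I R = 0) (hγ : 1 < γ) {C : ℝ≥0} (hC : 0 < C)
    (hmom : ∀ᶠ n : ℕ in atTop, ∫⁻ x, (x : ℝ≥0∞) ^ (γ * n) ∂(ν n) ≤ (C : ℝ≥0∞) ^ n)
    (hτ : ∀ r : ℝ, R ≤ r → ∀ s : ℝ≥0, I r ≤ s → τ ≤ 2 * s - Real.log (2 * r))
    {ε : ℝ} (hε : 0 < ε) : ∀ᶠ n : ℕ in atTop,
      ∫⁻ z, ((z.1 : ℝ≥0∞) + z.2) ^ n ∂((ν n).prod (ν n)) ≤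
        ENNReal.ofReal (Real.exp (n * (-τ + ε))) := by
  have hR' : (0 : ℝ) < R := hR
  -- The term `-log 2` absorbs the factor `2^n` from bounding the sum by twice the larger mark.
  obtain ⟨B, hB⟩ := exists_tail_le hγ hC hmom (-τ - Real.log 2)
  set η : ℝ := R * (ε / 4)
  have hη : 0 < η := by positivity
  have hηR : η / R = ε / 4 := by simp only [η]; field_simp
  obtain ⟨N, hN⟩ := exists_nat_gt (B / η)
  have hcells : ∀ᶠ n : ℕ in atTop, ∀ p ∈ Finset.range N ×ˢ Finset.range N,
      ENNReal.ofReal ((p.1 + p.2 + 2) * η) ^ n *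
      (ν n ((↑) ⁻¹' cell η p.1) * ν n ((↑) ⁻¹' cell η p.2)) ≤
        ENNReal.ofReal (Real.exp (n * (-τ + ε / 2))) := by
    rw [Filter.eventually_all_finset]
    intro p _
    refine (h.eventually_cells_le hν hconv hR hIR hτ hη (show 0 < ε / 4 by positivity)
      p.1 p.2).mono fun n hn => hn.trans_eq ?_
    rw [hηR]
    congr 3
    ring
  -- There are `N * N` pairs of cells and two tail terms, a number independent of `n`, so half of
  -- `ε` absorbs it.
  have hconst : ∀ᶠ n : ℕ in atTop, ((N * N + 2 : ℕ) : ℝ) ≤ Real.exp (n * (ε / 2)) :=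
    (Real.tendsto_exp_atTop.comp (tendsto_natCast_atTop_atTop.atTop_mul_const
      (half_pos hε))).eventually_ge_atTop _
  filter_upwards [hcells, hB, hconst, eventually_ne_atTop 0] with n h1 h2 h3 h0
  have := hν n h0
  have htail : 2 ^ n * (2 * ∫⁻ x in Ioi B, (x : ℝ≥0∞) ^ n ∂(ν n)) ≤
      2 * ENNReal.ofReal (Real.exp (n * (-τ + ε / 2))) :=
    calc _ ≤ 2 ^ n * (2 * ENNReal.ofReal (Real.exp (n * (-τ - Real.log 2)))) := by gcongr
      _ = 2 * (ENNReal.ofReal 2 ^ n * ENNReal.ofReal (Real.exp (n * (-τ - Real.log 2)))) := by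
          rw [ENNReal.ofReal_ofNat]; ring
      _ = 2 * ENNReal.ofReal (Real.exp (n * -τ)) := by
          rw [ofReal_pow_eq_exp two_pos, ← ENNReal.ofReal_mul (Real.exp_nonneg _), ← Real.exp_add]
          congr 3
          ring
      _ ≤ _ := by
          gcongr
          linarith
  calc _ ≤ _ := lintegral_add_pow_le hη hN n
    _ ≤ (N * N) • ENNReal.ofReal (Real.exp (n * (-τ + ε / 2))) +
          2 * ENNReal.ofReal (Real.exp (n * (-τ + ε / 2))) := by
        refine add_le_add ((Finset.sum_le_card_nsmul _ _ _ h1).trans_eq ?_) htail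
        rw [Finset.card_product, Finset.card_range]
    _ = ENNReal.ofReal (((N * N + 2 : ℕ) : ℝ) * Real.exp (n * (-τ + ε / 2))) := by
        rw [ENNReal.ofReal_mul (by positivity), ENNReal.ofReal_natCast, nsmul_eq_mul, ← add_mul]
        norm_cast
    _ ≤ ENNReal.ofReal (Real.exp (n * (ε / 2)) * Real.exp (n * (-τ + ε / 2))) := by gcongr
    _ = _ := by
        rw [← Real.exp_add]
        congr 2
        ring

/-- The logarithmic asymptotics of the `n`-th moment of the sum of two independent marks. -/
theorem HasExpBounds.hasExpRate_lintegral (h : HasExpBounds ν I)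
    (hν : ∀ n, n ≠ 0 → IsProbabilityMeasure (ν n)) (hconv : ConvexOn ℝ≥0 univ I)
    (hR : 0 < R) (hIR : I R = 0) (hγ : 1 < γ) {C : ℝ≥0} (hC : 0 < C)
    (hmom : ∀ᶠ n : ℕ in atTop, ∫⁻ x, (x : ℝ≥0∞) ^ (γ * n) ∂(ν n) ≤ (C : ℝ≥0∞) ^ n)
    (hτ : ∀ r : ℝ, R ≤ r → ∀ s : ℝ≥0, I r ≤ s → τ ≤ 2 * s - Real.log (2 * r))
    (hτ' : ∀ ε > 0, ∃ r : ℝ, R ≤ r ∧ ∃ s : ℝ≥0, I r ≤ s ∧ 2 * s - Real.log (2 * r) < τ + ε) :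
    HasExpRate (fun n => ∫⁻ z, ((z.1 : ℝ≥0∞) + z.2) ^ n ∂((ν n).prod (ν n))) (-τ) :=
  fun _ hε => (h.eventually_ge hν hR hτ' hε).and
    (h.eventually_le hν hconv hR hIR hγ hC hmom hτ hε)

end Laplace

/-! ### The degree threshold -/

theorem coe_ennreal_two_mul_sub (s : ℝ≥0) (c : ℝ) :
    2 * (((s : ℝ≥0∞) : EReal)) - (c : EReal) = ((2 * s - c : ℝ) : EReal) := by
  rw [EReal.coe_sub, EReal.coe_mul]
  rfl

/-- The infimum in the definition of the degree threshold is a real number. -/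
theorem exists_iInf_eq_coe {I : ℝ → ℝ≥0∞} {R : ℝ≥0} (hIR : I R = 0)
    (hb : ∃ b : ℝ, ∀ r : ℝ, R ≤ r → ∀ s : ℝ≥0, I r ≤ s → b ≤ 2 * s - Real.log (2 * r)) :
    ∃ τ : ℝ, ⨅ r ∈ Ici (2 * (R : ℝ)), (2 * (I (r / 2) : EReal) - ((Real.log r : ℝ) : EReal)) =
        (τ : EReal) ∧
      (∀ r : ℝ, R ≤ r → ∀ s : ℝ≥0, I r ≤ s → τ ≤ 2 * s - Real.log (2 * r)) ∧
      ∀ ε > 0, ∃ r : ℝ, R ≤ r ∧ ∃ s : ℝ≥0, I r ≤ s ∧ 2 * s - Real.log (2 * r) < τ + ε := by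
  obtain ⟨b, hb⟩ := hb
  set F : ℝ → EReal := fun r => 2 * (I (r / 2) : EReal) - ((Real.log r : ℝ) : EReal) with hF
  have hfin (r : ℝ) (s : ℝ≥0) (hs : I r = s) : F (2 * r) = ((2 * s - Real.log (2 * r) : ℝ) : EReal) := by
    simp only [hF]
    rw [← coe_ennreal_two_mul_sub, ← hs, mul_div_cancel_left₀ r two_ne_zero]
  have htop (r : ℝ) (hr : I (r / 2) = ⊤) : F r = ⊤ := by
    simp only [hF, hr]
    rw [EReal.coe_ennreal_top, EReal.mul_top_of_pos (by norm_num), EReal.top_sub_coe]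
  have hbot : (b : EReal) ≤ ⨅ r ∈ Ici (2 * (R : ℝ)), F r := by
    refine le_iInf₂ fun r hr => ?_
    have hr' : 2 * (R : ℝ) ≤ r := hr
    by_cases hI : I (r / 2) = ⊤
    · rw [htop r hI]; exact le_top
    · have hs := (ENNReal.coe_toNNReal hI).symm
      have := hfin (r / 2) _ hs
      rw [mul_div_cancel₀ r two_ne_zero] at this
      rw [this, EReal.coe_le_coe_iff]
      have := hb (r / 2) (by linarith) _ hs.le
      rwa [mul_div_cancel₀ r two_ne_zero] at this
  have hle (r : ℝ) (hr : R ≤ r) (s : ℝ≥0) (hs : I r ≤ s) :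
      ⨅ r ∈ Ici (2 * (R : ℝ)), F r ≤ ((2 * s - Real.log (2 * r) : ℝ) : EReal) := by
    have hI : I r ≠ ⊤ := (hs.trans_lt ENNReal.coe_lt_top).ne
    refine (iInf₂_le (2 * r) (by simpa using hr)).trans ?_
    rw [hfin r _ (ENNReal.coe_toNNReal hI).symm, EReal.coe_le_coe_iff]
    have : ((I r).toNNReal : ℝ) ≤ s := by
      rw [← ENNReal.coe_toNNReal hI] at hs
      exact_mod_cast hs
    linarith
  have hne_bot : ⨅ r ∈ Ici (2 * (R : ℝ)), F r ≠ ⊥ :=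
    ((EReal.bot_lt_coe b).trans_le hbot).ne'
  -- The endpoint `2 R` has the finite value `-log (2 R)`, since the rate vanishes at `R`.
  have hne_top : ⨅ r ∈ Ici (2 * (R : ℝ)), F r ≠ ⊤ :=
    ((hle R le_rfl 0 (by rw [hIR]; exact zero_le)).trans_lt (EReal.coe_lt_top _)).ne
  have hτ := EReal.coe_toReal hne_top hne_bot
  refine ⟨_, hτ.symm, fun r hr s hs => ?_, fun ε hε => ?_⟩
  · have := hle r hr s hs
    rw [← hτ, EReal.coe_le_coe_iff] at this
    exact this
  · have hlt : ⨅ r ∈ Ici (2 * (R : ℝ)), F r <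
        (((⨅ r ∈ Ici (2 * (R : ℝ)), F r).toReal + ε : ℝ) : EReal) := by
      conv_lhs => rw [← hτ]
      rw [EReal.coe_lt_coe_iff]
      linarith
    obtain ⟨r, hr⟩ := iInf_lt_iff.1 hlt
    obtain ⟨hrR, hr⟩ := iInf_lt_iff.1 hr
    have hrR' : 2 * (R : ℝ) ≤ r := hrR
    have hI : I (r / 2) ≠ ⊤ := fun hI => by
      rw [htop r hI] at hr
      exact not_top_lt hr
    have hs := (ENNReal.coe_toNNReal hI).symm
    have h1 := hfin (r / 2) _ hs
    refine ⟨r / 2, by linarith, _, hs.le, ?_⟩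
    rw [mul_div_cancel₀ r two_ne_zero] at h1 ⊢
    rw [h1, EReal.coe_lt_coe_iff] at hr
    exact hr

/-- The moment condition, as an eventual bound. -/
theorem exists_moment_le {Ω : Type*} [MeasurableSpace Ω] {P : Measure Ω} {X : ℕ → Ω → ℝ≥0}
    (hX : ∀ n, 1 ≤ n → AEMeasurable (X n) P) {γ : ℝ}
    (hmoment : limsup (fun n : ℕ =>
      (∫⁻ ω, (X n ω : ℝ≥0∞) ^ (γ * n) ∂P) ^ (1 / (n : ℝ))) atTop < ⊤) :
    ∃ C : ℝ≥0, 0 < C ∧ ∀ᶠ n : ℕ in atTop,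
      ∫⁻ x, (x : ℝ≥0∞) ^ (γ * n) ∂(P.map (X n)) ≤ (C : ℝ≥0∞) ^ n := by
  obtain ⟨C, hC, -⟩ := ENNReal.lt_iff_exists_nnreal_btwn.1 hmoment
  refine ⟨C, by exact_mod_cast zero_le.trans_lt hC, ?_⟩
  filter_upwards [eventually_lt_of_limsup_lt hC, eventually_ge_atTop 1] with n hn h1
  have h0 : (n : ℝ) ≠ 0 := by positivity
  rw [lintegral_map' (by fun_prop) (hX n h1)]
  have := pow_le_pow_left' hn.le n
  rwa [← ENNReal.rpow_natCast, ← ENNReal.rpow_mul, one_div_mul_cancel h0, ENNReal.rpow_one] at this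

end ShannonBoolean

theorem theorem2 {Ω : Type*} [MeasurableSpace Ω] (P : Measure Ω) [IsProbabilityMeasure P]
    -- normalized logarithmic intensities and their limit
    (ρseq : ℕ → ℝ) (ρ : ℝ) (hρ : Tendsto ρseq atTop (𝓝 ρ))
    -- in each dimension `n ≥ 1`: points, marks, and a variable with the law of the marks
    (T : (n : ℕ) → ℕ → Ω → ShannonBoolean.Space n) (X : ℕ → ℕ → Ω → ℝ≥0) (Xbar : ℕ → Ω → ℝ≥0)
    (hPoisson : ∀ n, 1 ≤ n → ShannonBoolean.IsMarkedPoissonProcess P (T n) (X n) (Xbar n)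
      (Real.exp (n * ρseq n)).toNNReal)
    -- the means of the marks converge to `R* ∈ (0, ∞)`
    (Rstar : ℝ≥0) (hRpos : 0 < Rstar)
    (hmean : Tendsto (fun n => ∫⁻ ω, (Xbar n ω : ℝ≥0∞) ∂P) atTop (𝓝 (Rstar : ℝ≥0∞)))
    -- large deviations principle with a good convex rate function
    (I : ℝ → ℝ≥0∞) (hgood : ShannonBoolean.IsGoodRate I) (hconv : ConvexOn ℝ≥0 univ I)
    (hLDP : ShannonBoolean.SatisfiesLDP (fun n => P.map (fun ω => (Xbar n ω : ℝ))) I)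
    -- moment condition
    (γ : ℝ) (hγ : 1 < γ)
    (hmoment : limsup (fun n : ℕ =>
      (∫⁻ ω, (Xbar n ω : ℝ≥0∞) ^ (γ * n) ∂P) ^ (1 / (n : ℝ))) atTop < ⊤) :
    ∃ τ : ℝ, ShannonBoolean.degreeThreshold I Rstar = (τ : EReal) ∧
      -- logarithmic asymptotics of the mean degree
      Tendsto (fun n : ℕ =>
        ENNReal.log (ShannonBoolean.meanDegree P (T n) (X n) (Real.exp (n * ρseq n)).toNNReal) /
          (n : EReal)) atTop (𝓝 ((ρ - τ : ℝ) : EReal)) ∧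
      -- below the threshold: exponential decay to `0`
      (ρ < τ →
        Tendsto (fun n : ℕ => ShannonBoolean.meanDegree P (T n) (X n)
          (Real.exp (n * ρseq n)).toNNReal) atTop (𝓝 0) ∧
        ∃ c : ℝ, 0 < c ∧ ∀ᶠ n : ℕ in atTop,
          ShannonBoolean.meanDegree P (T n) (X n) (Real.exp (n * ρseq n)).toNNReal ≤
            ENNReal.ofReal (Real.exp (-(c * n)))) ∧
      -- above the threshold: exponential growth to `∞`
      (τ < ρ →
        Tendsto (fun n : ℕ => ShannonBoolean.meanDegree P (T n) (X n)
          (Real.exp (n * ρseq n)).toNNReal) atTop (𝓝 ⊤) ∧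
        ∃ c : ℝ, 0 < c ∧ ∀ᶠ n : ℕ in atTop,
          ENNReal.ofReal (Real.exp (c * n)) ≤
            ShannonBoolean.meanDegree P (T n) (X n) (Real.exp (n * ρseq n)).toNNReal) := by
  have hXm (n : ℕ) (hn : 1 ≤ n) : AEMeasurable (Xbar n) P :=
    ((hPoisson n hn).marks_law 0).aemeasurable_snd
  have hν (n : ℕ) (hn : n ≠ 0) : IsProbabilityMeasure (P.map (Xbar n)) :=
    Measure.isProbabilityMeasure_map (hXm n (Nat.one_le_iff_ne_zero.2 hn))
  have hmean' : Tendsto (fun n => ∫⁻ x, (x : ℝ≥0∞) ∂(P.map (Xbar n))) atTop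
      (𝓝 (Rstar : ℝ≥0∞)) := by
    refine hmean.congr' ?_
    filter_upwards [eventually_ge_atTop 1] with n hn
    rw [lintegral_map' (by fun_prop) (hXm n hn)]
  have hbounds := hLDP.hasExpBounds hXm
  obtain ⟨C, hC, hmom⟩ := ShannonBoolean.exists_moment_le hXm hmoment
  have hIR := hbounds.rate_eq_zero hν hgood hconv hRpos hmean' hγ hC hmom
  obtain ⟨τ, hτ, hτle, hτlt⟩ := ShannonBoolean.exists_iInf_eq_coe hIR
    (hbounds.exists_lower_bound hRpos hγ hC hmom)
  set κ : ℝ := 1 / 2 * Real.log (2 * Real.pi * Real.exp 1)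
  have hrate : ShannonBoolean.HasExpRate (fun n : ℕ => ShannonBoolean.meanDegree P (T n) (X n)
      (Real.exp (n * ρseq n)).toNNReal) (ρ - (-κ + τ)) := by
    -- Intensity, volume of the ball of radius `√n`, and moment of the sum of two marks contribute
    -- `ρ`, `κ` and `-τ`; here `τ` is the bare infimum, and the threshold is `-κ + τ`.
    have hprod := ((ShannonBoolean.hasExpRate_exp hρ).mul
      ShannonBoolean.hasExpRate_sqrtBallVolume).mul
      (hbounds.hasExpRate_lintegral hν hconv hRpos hIR hγ hC hmom hτle hτlt)
    rw [show ρ - (-κ + τ) = ρ + κ + -τ by ring]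
    refine hprod.congr ?_
    filter_upwards [eventually_ge_atTop 1] with n hn
    have hn0 : n ≠ 0 := Nat.one_le_iff_ne_zero.1 hn
    rw [(hPoisson n hn).meanDegree_eq hn0 (by simpa using Real.exp_pos _), mul_assoc]
    simp only [ShannonBoolean.volume_ball_mul_sqrt hn0]
    rw [lintegral_const_mul _ (by fun_prop)]
    rfl
  refine ⟨-κ + τ, ?_, hrate.tendsto_log, fun hlt => ?_, fun hlt => ?_⟩
  · rw [ShannonBoolean.degreeThreshold, hτ, ← EReal.coe_add, neg_mul]
  · obtain ⟨c, hc, hle⟩ := hrate.exists_le_of_neg (sub_neg.2 hlt)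
    exact ⟨tendsto_of_tendsto_of_tendsto_of_le_of_le' tendsto_const_nhds
      (ShannonBoolean.tendsto_ofReal_exp_neg hc) (Eventually.of_forall fun _ => zero_le) hle,
      c, hc, hle⟩
  · obtain ⟨c, hc, hge⟩ := hrate.exists_ge_of_pos (sub_pos.2 hlt)
    exact ⟨tendsto_of_tendsto_of_tendsto_of_le_of_le' (ShannonBoolean.tendsto_ofReal_exp hc)
      tendsto_const_nhds hge (Eventually.of_forall fun _ => le_top), c, hc, hge⟩
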